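/- Let $\psi=\Gamma'/\Gamma$ be the digamma function and $H_m=\sum_{i=1}^m \frac1i$. For every integer $n\ge 0$ the series \[ S(n)=\sum_{k=1}^\infty \frac{\frac18\psi\left(\frac{2k+2n+5}{4}\right)-\psi\left(\frac{k+2n+5}{4}\right)+\psi\left(\frac{k+2n+3}{4}\right)-\frac18\psi\left(\frac{2k+2n+3}{4}\right)}{k^2} \] converges, and there are rational numbers $b_0,b_1,a_2,a_3$ (depending on $n$) with $S(n)=b_0+b_1\ln 2+a_2\pi^2+a_3\pi^3$. Explicitly: (a) $S(0)=2(1+\ln 2)-\frac{7\pi^2}{12}+\frac{5\pi^3}{96}$. (b) $S(1)=-\frac89\left(\frac53+2\ln 2\right)+\frac{7\pi^2}{18}-\frac{5\pi^3}{96}$. (c) If $n$ is odd and $n\ne 1$, then \begin{align*} S(n)={}&-\frac{40}{27}-8\sum_{j=1}^{(n-1)/2}\frac{(2j+1)(2H_{4j+1}+H_{2j})}{(4j+3)^2(4j+1)^2}+4\sum_{j=1}^{(n-1)/2}\frac{3j+2}{(2j+1)(4j+3)^3}\\ &+\frac{7\pi^2}{2}\left(\frac19+\frac13\sum_{j=1}^{(n-1)/2}\frac{1}{(4j+3)(4j+1)}\right)\\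 &-16\ln 2\left(\frac19+\sum_{j=1}^{(n-1)/2}\frac{2j+1}{(4j+3)^2(4j+1)^2}\right)-\frac{5\pi^3}{96}. \end{align*} (d) If $n$ is even, then (with empty sums equal to $0$ when $n=0$) \begin{align*} S(n)={}&2-16\sum_{j=0}^{(n-2)/2}\frac{(j+1)(2H_{4j+3}+H_{2j+1})}{(4j+5)^2(4j+3)^2}+\sum_{j=0}^{(n-2)/2}\frac{6j+7}{(j+1)(4j+5)^3}\\ &-\frac{7\pi^2}{2}\left(\frac16-\frac13\sum_{j=0}^{(n-2)/2}\frac{1}{(4j+5)(4j+3)}\right)\\ &+2\ln 2\left(1-16\sum_{j=0}^{(n-2)/2}\frac{j+1}{(4j+5)^2(4j+3)^2}\right)+\frac{5\pi^3}{96}. \end{align*} -/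

import Mathlib

/-- The `k`-th term (`k ≥ 1`) of the digamma series with parameter `n`. -/
noncomputable def digammaTerm (n k : ℕ) : ℂ :=
  ((1 / 8) * Complex.digamma ((2 * (k : ℂ) + 2 * (n : ℂ) + 5) / 4)
      - Complex.digamma (((k : ℂ) + 2 * (n : ℂ) + 5) / 4)
      + Complex.digamma (((k : ℂ) + 2 * (n : ℂ) + 3) / 4)
      - (1 / 8) * Complex.digamma ((2 * (k : ℂ) + 2 * (n : ℂ) + 3) / 4)) / (k : ℂ) ^ 2

/-- The sum of the digamma series over `k = 1, 2, 3, …` converges to the real number `S`. -/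
def DigammaSeriesHasSum (n : ℕ) (S : ℝ) : Prop :=
  HasSum (fun k : ℕ => digammaTerm n (k + 1)) (S : ℂ)

/-- The harmonic number `H_m = ∑_{i=1}^m 1/i`, as a real number. -/
noncomputable def realHarmonic (m : ℕ) : ℝ := (harmonic m : ℝ)

open Filter Topology

/-! Write `M(N) = ∫₀¹ xᴺ/(1+x²) dx`. Digamma values half a unit apart differ by four times such a
moment (`realDigamma_sub`). The series with parameter `n` is therefore `T(n+1)`, where `T(n) = ∑
(M(2k+2n)/2 - 4 M(k+2n))/k²` (`digammaTerm_eq`).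

Since `M(N) + M(N+2) = 1/(N+1)`, the sum `T(n) + T(n+1)` is a series of rational functions of `k`.
Partial fractions evaluate it in terms of harmonic numbers, `log 2` and `π²`
(`hasSum_momentTerm_add`). Everything then follows by induction from `T(0)`, and the closed forms
come from applying the recurrence two steps at a time.

The analytic core is `T(0) = -5π³/96`. Summing under the integral, and using `Li₂(x²)/2 = Li₂(x) +
Li₂(-x)`, turns `T(0)` into `∫₀¹ (Li₂(-x) - 3 Li₂(x))/(1+x²) dx`. Put `L = log(1+ix)`, so that
`arctan x = Im L`, and integrate by parts. What remains is `arctan x · (3 log(1-x) - log(1+x))/x`,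
which is half the imaginary part of a combination of the squares `(L - log(1-x))²`, `(L -
log(1+x))²` and `L²`, divided by `x` (`im_neg_three_mul_sq_add`). Each square over `x` has an
explicit trilogarithmic antiderivative. At the endpoints `ζ(3)` and the trilogarithms at `(1±i)/2`
cancel, leaving `Im Li₃(i) = π³/32` and `Re Li₂((1+i)/2)`; the latter comes from Euler's reflection
formula. -/

/-! ### Digamma differences as moments of `1/(1+x²)` -/

theorem Complex.digamma_ofReal {x : ℝ} (hx : 0 < x) :
    Complex.digamma (x : ℂ) = ((deriv (Real.log ∘ Real.Gamma) x : ℝ) : ℂ) := by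
  have hd : DifferentiableAt ℝ Real.Gamma x :=
    Real.differentiableAt_Gamma fun m => ne_of_gt (by
      have : (0 : ℝ) ≤ m := m.cast_nonneg
      linarith)
  have hc : DifferentiableAt ℂ Complex.Gamma (x : ℂ) := by
    refine Complex.differentiableAt_Gamma _ fun m hm => ?_
    have h1 := congrArg Complex.re hm
    simp at h1
    have : (0 : ℝ) ≤ m := m.cast_nonneg
    linarith
  have h1 : HasDerivAt (fun y : ℝ => Complex.Gamma y) (deriv Complex.Gamma x) x :=
    hc.hasDerivAt.comp_ofReal
  have h2 : HasDerivAt (fun y : ℝ => ((Real.Gamma y : ℝ) : ℂ)) ((deriv Real.Gamma x : ℝ) : ℂ) x :=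
    hd.hasDerivAt.ofReal_comp
  simp only [← Complex.Gamma_ofReal] at h2
  rw [Complex.digamma_def, logDeriv_apply, h1.unique h2, Complex.Gamma_ofReal]
  have h3 : deriv (Real.log ∘ Real.Gamma) x = deriv Real.Gamma x / Real.Gamma x :=
    (hd.hasDerivAt.log (Real.Gamma_pos_of_pos hx).ne').deriv
  rw [h3]
  push_cast
  rfl

/-- The derivative of `log Γ` on the positive reals. -/
noncomputable def realDigamma (x : ℝ) : ℝ := deriv (Real.log ∘ Real.Gamma) x

theorem realDigamma_add_one {x : ℝ} (hx : 0 < x) :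
    realDigamma (x + 1) = realDigamma x + x⁻¹ := by
  have h := Complex.digamma_apply_add_one (x : ℂ) (fun m hm => by
    have h1 := congrArg Complex.re hm
    simp at h1
    have : (0 : ℝ) ≤ m := m.cast_nonneg
    linarith)
  have e : (x : ℂ) + 1 = ((x + 1 : ℝ) : ℂ) := by push_cast; rfl
  rw [e, Complex.digamma_ofReal hx, Complex.digamma_ofReal (by linarith)] at h
  exact_mod_cast h

/-- Log-convexity of `Γ`. This is the only growth information on the digamma function that is
needed. -/
theorem monotoneOn_realDigamma : MonotoneOn realDigamma (Set.Ioi 0) := by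
  refine Real.convexOn_log_Gamma.monotoneOn_deriv fun x hx => ?_
  have hx : 0 < x := hx
  exact (Real.differentiableAt_Gamma fun m => ne_of_gt (by
      have : (0 : ℝ) ≤ m := m.cast_nonneg
      linarith)).log (Real.Gamma_pos_of_pos hx).ne'

/-- The moments `∫₀¹ xᴺ / (1 + x²) dx`. -/
noncomputable def arctanMoment (N : ℕ) : ℝ := ∫ x in (0 : ℝ)..1, x ^ N / (1 + x ^ 2)

theorem continuous_pow_div_one_add_sq (N : ℕ) :
    Continuous fun x : ℝ => x ^ N / (1 + x ^ 2) := by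
  refine Continuous.div (by fun_prop) (by fun_prop) fun x => by positivity

theorem arctanMoment_add (N : ℕ) :
    arctanMoment N + arctanMoment (N + 2) = 1 / ((N : ℝ) + 1) := by
  unfold arctanMoment
  rw [← intervalIntegral.integral_add ((continuous_pow_div_one_add_sq _).intervalIntegrable _ _)
    ((continuous_pow_div_one_add_sq _).intervalIntegrable _ _)]
  have : ∀ x : ℝ, x ^ N / (1 + x ^ 2) + x ^ (N + 2) / (1 + x ^ 2) = x ^ N := fun x => by
    have : 1 + x ^ 2 ≠ 0 := by positivity
    field_simp
    ring
  simp_rw [this]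
  simp

theorem arctanMoment_nonneg (N : ℕ) : 0 ≤ arctanMoment N :=
  intervalIntegral.integral_nonneg zero_le_one fun x hx => by
    have := hx.1
    positivity

/-- Both sides obey the same two-step recurrence, so their difference `E` changes sign under `N ↦ N
+ 2`. It also tends to zero, hence it vanishes. No integral representation of the digamma function
is required. -/
theorem realDigamma_sub (N : ℕ) :
    realDigamma (((N : ℝ) + 5) / 4) - realDigamma (((N : ℝ) + 3) / 4)
      = 4 * arctanMoment (N + 2) := by
  set E : ℕ → ℝ := fun N => realDigamma (((N : ℝ) + 5) / 4) - realDigamma (((N : ℝ) + 3) / 4)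
      - 4 * arctanMoment (N + 2) with hE
  have hrec : ∀ N, E (N + 2) = -E N := fun N => by
    have h1 := realDigamma_add_one (x := ((N : ℝ) + 3) / 4) (by positivity)
    have h2 := arctanMoment_add (N + 2)
    simp only [hE]
    rw [show (((N + 2 : ℕ) : ℝ) + 5) / 4 = ((N : ℝ) + 3) / 4 + 1 by push_cast; ring,
      show (((N + 2 : ℕ) : ℝ) + 3) / 4 = ((N : ℝ) + 5) / 4 by push_cast; ring, h1]
    rw [inv_div] at *
    push_cast at h2
    have h3 : (1 : ℝ) / (N + 2 + 1) = 1 / (N + 3) := by ring_nf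
    rw [h3] at h2
    linear_combination -4 * h2
  -- Monotonicity traps `(N+5)/4` between `(N+3)/4` and `(N+3)/4 + 1`, so the digamma difference
  -- lies in `[0, 4/(N+3)]`. The moment term lies in the same interval.
  have hbound : ∀ N, |E N| ≤ 8 / ((N : ℝ) + 3) := fun N => by
    have h1 := realDigamma_add_one (x := ((N : ℝ) + 3) / 4) (by positivity)
    have h2 := arctanMoment_add (N + 2)
    have h3 := arctanMoment_nonneg (N + 2)
    have h4 := arctanMoment_nonneg (N + 2 + 2)
    have m1 := monotoneOn_realDigamma (a := ((N : ℝ) + 3) / 4) (b := ((N : ℝ) + 5) / 4)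
      (Set.mem_Ioi.2 (by positivity)) (Set.mem_Ioi.2 (by positivity)) (by linarith)
    have m2 := monotoneOn_realDigamma (a := ((N : ℝ) + 5) / 4) (b := ((N : ℝ) + 3) / 4 + 1)
      (Set.mem_Ioi.2 (by positivity)) (Set.mem_Ioi.2 (by positivity)) (by linarith)
    rw [inv_div] at h1
    push_cast at h2
    have h5 : (1 : ℝ) / (N + 2 + 1) = 1 / (N + 3) := by ring_nf
    rw [h5] at h2
    have h6 : (4 : ℝ) / (N + 3) = 4 * (1 / (N + 3)) := by ring
    have h7 : (8 : ℝ) / (N + 3) = 8 * (1 / (N + 3)) := by ring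
    rw [h7]
    rw [h6] at h1
    simp only [hE]
    rw [abs_le]
    constructor <;> linarith
  have habs : ∀ N m, |E (N + 2 * m)| = |E N| := fun N m => by
    induction m with
    | zero => rfl
    | succ m ih => rw [show N + 2 * (m + 1) = N + 2 * m + 2 by ring, hrec, abs_neg, ih]
  have hlim : Tendsto (fun m : ℕ => 8 / (((N + 2 * m : ℕ) : ℝ) + 3)) atTop (𝓝 0) := by
    refine tendsto_const_nhds.div_atTop (tendsto_atTop_add_const_right _ _ ?_)
    refine tendsto_natCast_atTop_atTop.comp (tendsto_atTop_mono (fun m => ?_) tendsto_id)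
    simp only [id]
    omega
  have h0 : |E N| ≤ 0 := ge_of_tendsto' hlim fun m => by
    rw [← habs N m]
    exact hbound _
  exact sub_eq_zero.1 (abs_eq_zero.1 (le_antisymm h0 (abs_nonneg _)))

/-- The real form of the terms of the digamma series, with index shifted by one. -/
noncomputable def momentTerm (n k : ℕ) : ℝ :=
  (arctanMoment (2 * k + 2 * n) / 2 - 4 * arctanMoment (k + 2 * n)) / (k : ℝ) ^ 2

theorem digammaTerm_eq (n k : ℕ) : digammaTerm n k = (momentTerm (n + 1) k : ℂ) := by
  have h1 := realDigamma_sub (2 * k + 2 * n)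
  have h2 := realDigamma_sub (k + 2 * n)
  have key : ∀ N : ℕ, ∀ c : ℝ, 0 < c → Complex.digamma (((N : ℂ) + c) / 4)
      = ((realDigamma (((N : ℝ) + c) / 4) : ℝ) : ℂ) := fun N c hc => by
    rw [realDigamma, ← Complex.digamma_ofReal (by positivity)]
    push_cast
    rfl
  have k1 := key (2 * k + 2 * n) 5 (by norm_num)
  have k2 := key (2 * k + 2 * n) 3 (by norm_num)
  have k3 := key (k + 2 * n) 5 (by norm_num)
  have k4 := key (k + 2 * n) 3 (by norm_num)
  push_cast at k1 k2 k3 k4 h1 h2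
  rw [digammaTerm, k1, k2, k3, k4, momentTerm]
  rw [show 2 * k + 2 * (n + 1) = 2 * k + 2 * n + 2 by ring, show k + 2 * (n + 1) = k + 2 * n + 2 by ring]
  have e1 : arctanMoment (2 * k + 2 * n + 2) = _ := (eq_div_of_mul_eq (by norm_num) (mul_comm _ _ |>.trans h1.symm))
  have e2 : arctanMoment (k + 2 * n + 2) = _ := (eq_div_of_mul_eq (by norm_num) (mul_comm _ _ |>.trans h2.symm))
  rw [e1, e2]
  push_cast
  ring

/-! ### The sum of two consecutive series -/

theorem momentTerm_add (n k : ℕ) :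
    momentTerm n k + momentTerm (n + 1) k
      = (1 / 2 / (2 * (k : ℝ) + (2 * n + 1)) - 4 / ((k : ℝ) + (2 * n + 1))) / (k : ℝ) ^ 2 := by
  have h1 := arctanMoment_add (2 * k + 2 * n)
  have h2 := arctanMoment_add (k + 2 * n)
  push_cast at h1 h2
  rw [momentTerm, momentTerm, show 2 * k + 2 * (n + 1) = 2 * k + 2 * n + 2 by ring,
    show k + 2 * (n + 1) = k + 2 * n + 2 by ring, ← add_div]
  congr 1
  rw [← add_assoc, ← add_assoc]
  linear_combination (1 / 2) * h1 - 4 * h2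

theorem hasSum_sub_succ_of_antitone {f : ℕ → ℝ} (hf : Antitone f)
    (h0 : Tendsto f atTop (𝓝 0)) : HasSum (fun k => f k - f (k + 1)) (f 0) := by
  rw [hasSum_iff_tendsto_nat_of_nonneg fun k => sub_nonneg.2 (hf (Nat.le_succ k))]
  simp_rw [Finset.sum_range_sub']
  simpa using h0.const_sub (f 0)

theorem hasSum_inv_sub_inv_succ {a b c : ℝ} (ha : 0 < a) (hb : 0 < b) (hc : 0 ≤ c) :
    HasSum (fun k : ℕ => c / (a * k + b) - c / (a * (k + 1) + b)) (c / b) := by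
  have h := hasSum_sub_succ_of_antitone (f := fun k : ℕ => c / (a * k + b)) ?_ ?_
  · simpa using h
  · intro i j hij
    have : (i : ℝ) ≤ j := by exact_mod_cast hij
    dsimp only
    gcongr
  · exact tendsto_const_nhds.div_atTop (tendsto_atTop_add_const_right _ _
      (tendsto_natCast_atTop_atTop.const_mul_atTop ha))

theorem hasSum_inv_sub_inv_add (p : ℕ) :
    HasSum (fun k : ℕ => 1 / ((k : ℝ) + 1) - 1 / ((k : ℝ) + 1 + p)) (realHarmonic p) := by
  induction p with
  | zero => simp [realHarmonic, hasSum_zero]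
  | succ p ih =>
    have h := ih.add (hasSum_inv_sub_inv_succ (a := 1) (b := (p : ℝ) + 1) (c := 1) one_pos
      (by positivity) zero_le_one)
    convert! h using 1
    · ext k
      push_cast
      ring_nf
    · rw [realHarmonic, harmonic_succ, realHarmonic]
      push_cast
      ring

theorem sum_range_inv_sub_two_div (N : ℕ) :
    ∑ k ∈ Finset.range N, (1 / ((k : ℝ) + 1) - 2 / (2 * ((k : ℝ) + 1) + 1))
      = 2 * realHarmonic N - 2 * realHarmonic (2 * N + 1) + 2 := by
  induction N with
  | zero => simp [realHarmonic, harmonic_succ]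
  | succ N ih =>
    rw [Finset.sum_range_succ, ih, show 2 * (N + 1) + 1 = (2 * N + 1) + 1 + 1 by ring]
    simp only [realHarmonic, harmonic_succ]
    push_cast
    have h1 : (N : ℝ) + 1 ≠ 0 := by positivity
    have h2 : 2 * (N : ℝ) + 1 + 1 ≠ 0 := by positivity
    have h3 : 2 * (N : ℝ) + 1 + 1 + 1 ≠ 0 := by positivity
    have h4 : 2 * ((N : ℝ) + 1) + 1 ≠ 0 := by positivity
    field_simp
    ring

/-- Euler's constant cancels between `H_N - log N` and `H_{2N} - log (2N)`, leaving only `log 2`. -/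
theorem tendsto_harmonic_sub_harmonic_two_mul :
    Tendsto (fun N : ℕ => 2 * realHarmonic N - 2 * realHarmonic (2 * N + 1) + 2) atTop
      (𝓝 (2 - 2 * Real.log 2)) := by
  have h := Real.tendsto_harmonic_sub_log
  have h2 : Tendsto (fun N : ℕ => 2 * N) atTop atTop :=
    tendsto_id.const_mul_atTop' (by norm_num)
  have h3 := h.comp h2
  have h4 : Tendsto (fun N : ℕ => 1 / (2 * (N : ℝ) + 1)) atTop (𝓝 0) :=
    tendsto_const_nhds.div_atTop (tendsto_atTop_add_const_right _ _
      (tendsto_natCast_atTop_atTop.const_mul_atTop two_pos))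
  have h5 := (((h.sub h3).sub h4).const_mul 2).add_const (2 - 2 * Real.log 2)
  simp only [sub_self, mul_zero, zero_add] at h5
  refine h5.congr' ?_
  filter_upwards [eventually_gt_atTop 0] with N hN
  have hN' : (0 : ℝ) < N := by exact_mod_cast hN
  simp only [Function.comp, realHarmonic, harmonic_succ]
  push_cast
  rw [Real.log_mul two_ne_zero hN'.ne']
  ring

theorem hasSum_inv_sub_two_div_odd (m : ℕ) :
    HasSum (fun k : ℕ => 1 / ((k : ℝ) + 1) - 2 / (2 * ((k : ℝ) + 1) + (2 * m + 1)))
      (2 * realHarmonic (2 * m + 1) - realHarmonic m - 2 * Real.log 2) := by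
  induction m with
  | zero =>
    rw [hasSum_iff_tendsto_nat_of_nonneg]
    · simp only [Nat.cast_zero, mul_zero, zero_add, sum_range_inv_sub_two_div]
      convert! tendsto_harmonic_sub_harmonic_two_mul using 2
      simp [realHarmonic, harmonic_succ]
    · intro k
      rw [sub_nonneg, div_le_div_iff₀ (by positivity) (by positivity)]
      push_cast
      linarith
  | succ m ih =>
    have h := ih.add (hasSum_inv_sub_inv_succ (a := 2) (b := 2 * (m : ℝ) + 3) (c := 2) two_pos
      (by positivity) zero_le_two)
    convert! h using 1
    · ext k
      push_cast
      ring_nf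
    · rw [show 2 * (m + 1) + 1 = (2 * m + 1) + 1 + 1 by ring]
      simp only [realHarmonic, harmonic_succ]
      push_cast
      have h1 : (m : ℝ) + 1 ≠ 0 := by positivity
      have h2 : 2 * (m : ℝ) + 1 + 1 ≠ 0 := by positivity
      have h3 : 2 * (m : ℝ) + 1 + 1 + 1 ≠ 0 := by positivity
      have h4 : 2 * (m : ℝ) + 3 ≠ 0 := by positivity
      field_simp
      ring

/-- The value of the sum of two consecutive digamma series. -/
noncomputable def consecutiveSum (n : ℕ) : ℝ :=
  (2 * realHarmonic (2 * n + 1) + realHarmonic n + 2 * Real.log 2) / (2 * n + 1) ^ 2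
    - 7 * Real.pi ^ 2 / (12 * (2 * n + 1))

theorem hasSum_momentTerm_add (n : ℕ) :
    HasSum (fun k => momentTerm n (k + 1) + momentTerm (n + 1) (k + 1)) (consecutiveSum n) := by
  have hz : HasSum (fun k : ℕ => 1 / ((k : ℝ) + 1) ^ 2) (Real.pi ^ 2 / 6) := by
    have := (hasSum_nat_add_iff' 1).2 hasSum_zeta_two
    simpa using this
  have hA := hasSum_inv_sub_inv_add (2 * n + 1)
  have hB := hasSum_inv_sub_two_div_odd n
  -- Partial fractions with `p = 2n + 1`. The coefficient of `1/k²` is `1/(2p) - 4/p = -7/(2p)`; the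
  -- simple poles group into the two convergent differences `hA` and `hB`.
  have h := ((hz.mul_left (-7 / (2 * (2 * (n : ℝ) + 1)))).add
    (hA.mul_left (4 / (2 * (n : ℝ) + 1) ^ 2))).sub (hB.mul_left (1 / (2 * (n : ℝ) + 1) ^ 2))
  convert! h using 1
  · ext k
    rw [momentTerm_add]
    push_cast
    have h1 : (k : ℝ) + 1 ≠ 0 := by positivity
    have h2 : 2 * (n : ℝ) + 1 ≠ 0 := by positivity
    have h3 : 2 * ((k : ℝ) + 1) + (2 * n + 1) ≠ 0 := by positivity
    have h4 : (k : ℝ) + 1 + (2 * n + 1) ≠ 0 := by positivity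
    field_simp
    ring
  · rw [consecutiveSum]
    have h2 : 2 * (n : ℝ) + 1 ≠ 0 := by positivity
    field_simp
    ring

/-! ### Polylogarithms on the closed unit disc -/

/-- The polylogarithm `Liₛ(z) = ∑ zⁿ / nˢ` as a power series. -/
noncomputable def polylogSeries (s : ℕ) (z : ℂ) : ℂ := ∑' n : ℕ, z ^ (n + 1) / ((n : ℂ) + 1) ^ s

theorem summable_inv_succ_pow {s : ℕ} (hs : 2 ≤ s) :
    Summable fun n : ℕ => 1 / ((n : ℝ) + 1) ^ s := by
  have := (summable_nat_add_iff 1).2 (Real.summable_one_div_nat_pow.2 (by omega : 1 < s))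
  simpa using this

theorem norm_polylogSeries_term_le (s n : ℕ) {z : ℂ} (hz : ‖z‖ ≤ 1) :
    ‖z ^ (n + 1) / ((n : ℂ) + 1) ^ s‖ ≤ 1 / ((n : ℝ) + 1) ^ s := by
  have h : ‖(n : ℂ) + 1‖ = (n : ℝ) + 1 := by
    rw [← Nat.cast_succ, Complex.norm_natCast]
    push_cast
    rfl
  rw [norm_div, norm_pow, norm_pow, h]
  gcongr
  exact pow_le_one₀ (norm_nonneg _) hz

theorem hasSum_polylogSeries {s : ℕ} (hs : 2 ≤ s) {z : ℂ} (hz : ‖z‖ ≤ 1) :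
    HasSum (fun n : ℕ => z ^ (n + 1) / ((n : ℂ) + 1) ^ s) (polylogSeries s z) :=
  (Summable.of_norm_bounded (summable_inv_succ_pow hs)
    fun n => norm_polylogSeries_term_le s n hz).hasSum

theorem continuousOn_polylogSeries {s : ℕ} (hs : 2 ≤ s) :
    ContinuousOn (polylogSeries s) (Metric.closedBall 0 1) :=
  continuousOn_tsum (fun _ => by fun_prop) (summable_inv_succ_pow hs)
    fun n _ hz => norm_polylogSeries_term_le s n (by simpa using hz)

theorem polylogSeries_zero (s : ℕ) : polylogSeries s 0 = 0 := by
  simp [polylogSeries]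

theorem polylogSeries_conj (s : ℕ) (z : ℂ) :
    polylogSeries s (starRingEnd ℂ z) = starRingEnd ℂ (polylogSeries s z) := by
  rw [polylogSeries, polylogSeries, Complex.conj_tsum]
  simp

theorem polylogSeries_one {z : ℂ} (hz : ‖z‖ < 1) : polylogSeries 1 z = -Complex.log (1 - z) := by
  rw [← (Complex.hasSum_taylorSeries_neg_log' hz).tsum_eq, polylogSeries]
  simp

/-- The derivative is kept as a series rather than divided by `z`, so that `z = 0` is allowed; that
case is needed at the endpoint `x = 1`. -/
theorem hasDerivAt_polylogSeries_succ (s : ℕ) {z : ℂ} (hz : ‖z‖ < 1) :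
    HasDerivAt (polylogSeries (s + 1)) (∑' n : ℕ, z ^ n / ((n : ℂ) + 1) ^ s) z := by
  obtain ⟨r, hr, hr1⟩ := exists_between hz
  have hr0 : 0 ≤ r := (norm_nonneg z).trans hr.le
  refine hasDerivAt_tsum_of_isPreconnected (𝕜 := ℂ)
    (g := fun (n : ℕ) z => z ^ (n + 1) / ((n : ℂ) + 1) ^ (s + 1))
    (g' := fun (n : ℕ) z => z ^ n / ((n : ℂ) + 1) ^ s) (u := fun n : ℕ => r ^ n)
    (t := Metric.ball 0 r) (y₀ := 0) (y := z) (summable_geometric_of_lt_one hr0 hr1)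
    Metric.isOpen_ball (convex_ball _ _).isPreconnected ?_ ?_
    (by simpa using (norm_nonneg z).trans_lt hr) ?_ (by simpa using hr)
  · intro n y _
    have h := ((hasDerivAt_pow (n + 1) y).div_const (((n : ℂ) + 1) ^ (s + 1)))
    convert! h using 1
    have : (n : ℂ) + 1 ≠ 0 := by exact_mod_cast n.succ_ne_zero
    push_cast
    field_simp
    ring
  · intro n y hy
    have hy : ‖y‖ < r := by simpa using hy
    have h : ‖(n : ℂ) + 1‖ = (n : ℝ) + 1 := by
      rw [← Nat.cast_succ, Complex.norm_natCast]
      push_cast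
      rfl
    rw [norm_div, norm_pow, norm_pow, h]
    refine (div_le_self (by positivity)
      (one_le_pow₀ (by linarith [n.cast_nonneg (α := ℝ)]))).trans ?_
    gcongr
  · simp

theorem hasDerivAt_polylogSeries (s : ℕ) {z : ℂ} (hz : ‖z‖ < 1) (h0 : z ≠ 0) :
    HasDerivAt (polylogSeries (s + 1)) (polylogSeries s z / z) z := by
  convert! hasDerivAt_polylogSeries_succ s hz using 1
  rw [polylogSeries, ← tsum_div_const]
  refine tsum_congr fun n => ?_
  field_simp
  ring

theorem hasDerivAt_dilog {z : ℂ} (hz : ‖z‖ < 1) (h0 : z ≠ 0) :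
    HasDerivAt (polylogSeries 2) (-Complex.log (1 - z) / z) z := by
  rw [← polylogSeries_one hz]
  exact hasDerivAt_polylogSeries 1 hz h0

theorem polylogSeries_two_one : polylogSeries 2 1 = ((Real.pi ^ 2 / 6 : ℝ) : ℂ) := by
  refine (hasSum_polylogSeries le_rfl (by simp)).unique ?_
  have := (hasSum_nat_add_iff' 1).2 hasSum_zeta_two
  rw [← Complex.hasSum_ofReal] at this
  simpa using this

theorem polylogSeries_two_add_neg {z : ℂ} (hz : ‖z‖ ≤ 1) :
    polylogSeries 2 z + polylogSeries 2 (-z) = polylogSeries 2 (z ^ 2) / 2 := by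
  have h1 := hasSum_polylogSeries (s := 2) le_rfl hz
  have h2 := hasSum_polylogSeries (s := 2) le_rfl (z := -z) (by simpa using hz)
  have h3 := hasSum_polylogSeries (s := 2) le_rfl (z := z ^ 2)
    (by rw [norm_pow]; exact pow_le_one₀ (norm_nonneg z) hz)
  refine (h1.add h2).unique ?_
  -- The series index is shifted by one, so the surviving even powers of `z` sit at odd indices.
  have hinj : Function.Injective fun n : ℕ => 2 * n + 1 := fun a b h => by simpa using h
  rw [← hinj.hasSum_iff]
  · convert! h3.div_const 2 using 1
    ext n
    simp only [Function.comp]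
    rw [show 2 * n + 1 + 1 = 2 * (n + 1) by ring, pow_mul, pow_mul]
    have : (n : ℂ) + 1 ≠ 0 := by exact_mod_cast n.succ_ne_zero
    push_cast
    rw [show (2 * (n : ℂ) + 1 + 1) = 2 * (n + 1) by ring]
    field_simp
    norm_num
  · intro n hn
    have : Even n := by
      by_contra h
      obtain ⟨m, rfl⟩ := Nat.not_even_iff_odd.1 h
      exact hn ⟨m, rfl⟩
    have hodd : Odd (n + 1) := this.add_one
    rw [hodd.neg_pow]
    ring

theorem polylogSeries_two_neg_one : polylogSeries 2 (-1) = ((-Real.pi ^ 2 / 12 : ℝ) : ℂ) := by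
  have h := polylogSeries_two_add_neg (z := 1) (by simp)
  rw [one_pow, polylogSeries_two_one] at h
  push_cast at h ⊢
  linear_combination h

/-- The imaginary part of `iⁿ` is `sin(πn/2)`, so this is the value at 3 of the Dirichlet L-function
of the character modulo 4. -/
theorem im_polylogSeries_three_I : (polylogSeries 3 Complex.I).im = Real.pi ^ 3 / 32 := by
  have h := Complex.hasSum_im (hasSum_polylogSeries (s := 3) (by norm_num) (z := Complex.I) (by simp))
  have h2 := (hasSum_nat_add_iff' 1).2 hasSum_L_function_mod_four_eval_three
  refine h.unique ?_
  simp only [Finset.range_one, Finset.sum_singleton, Nat.cast_zero, mul_zero, zero_div,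
    Real.sin_zero, sub_zero] at h2
  convert! h2 using 1
  ext n
  have h3 : Complex.I ^ (n + 1) = Complex.exp (((Real.pi * ((n + 1 : ℕ) : ℝ) / 2 : ℝ) : ℂ) * Complex.I) := by
    conv_lhs => rw [← Complex.exp_pi_div_two_mul_I, ← Complex.exp_nat_mul]
    push_cast
    ring_nf
  have h4 : ((n : ℂ) + 1) ^ 3 = ((((n + 1 : ℕ) : ℝ) ^ 3 : ℝ) : ℂ) := by push_cast; rfl
  rw [h3, h4, Complex.div_ofReal_im, Complex.exp_ofReal_mul_I_im]
  ring

/-! ### Endpoint limits, chain rules and complex logarithms -/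

theorem tendsto_mul_log_pow_nhdsGT_zero {f : ℝ → ℂ} (hf : DifferentiableAt ℝ f 0) (h0 : f 0 = 0)
    (n : ℕ) : Tendsto (fun x => f x * (Real.log x : ℂ) ^ n) (𝓝[>] 0) (𝓝 0) := by
  have h1 : f =O[𝓝[>] (0 : ℝ)] fun x : ℝ => x := by
    have := hf.isBigO_sub
    simp only [h0, sub_zero] at this
    exact this.mono nhdsWithin_le_nhds
  have h2 : (fun x : ℝ => (Real.log x : ℂ) ^ n) =o[𝓝[>] (0 : ℝ)] fun x : ℝ => x ^ (-1 : ℝ) := by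
    refine Asymptotics.IsLittleO.of_norm_left ?_
    have := isLittleO_abs_log_rpow_rpow_nhdsGT_zero (s := -1) n (by norm_num)
    refine this.congr_left fun x => ?_
    simp
  have h3 := h1.mul_isLittleO h2
  have h4 : (fun x : ℝ => x * x ^ (-1 : ℝ)) =ᶠ[𝓝[>] 0] fun _ => (1 : ℝ) := by
    filter_upwards [self_mem_nhdsWithin] with x hx
    have hx : 0 < x := hx
    rw [Real.rpow_neg_one, mul_inv_cancel₀ hx.ne']
  exact (Asymptotics.isLittleO_one_iff ℝ).1 (h3.trans_eventuallyEq h4)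

theorem tendsto_mul_log_one_sub_pow_nhdsLT_one {f : ℝ → ℂ} (hf : DifferentiableAt ℝ f 1)
    (h0 : f 1 = 0) (n : ℕ) :
    Tendsto (fun x => f x * (Real.log (1 - x) : ℂ) ^ n) (𝓝[<] 1) (𝓝 0) := by
  have h1 : DifferentiableAt ℝ (fun y => f (1 - y)) 0 := by
    have : DifferentiableAt ℝ f (1 - 0) := by simpa using hf
    exact this.comp (0 : ℝ) (by fun_prop)
  have h2 := tendsto_mul_log_pow_nhdsGT_zero h1 (by simpa using h0) n
  have h3 : Tendsto (fun x : ℝ => 1 - x) (𝓝[<] 1) (𝓝[>] 0) := by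
    refine tendsto_nhdsWithin_iff.2 ⟨?_, ?_⟩
    · have : Tendsto (fun x : ℝ => 1 - x) (𝓝 1) (𝓝 (1 - 1)) := by
        exact (continuous_const.sub continuous_id).tendsto 1
      rw [sub_self] at this
      exact this.mono_left nhdsWithin_le_nhds
    · filter_upwards [self_mem_nhdsWithin] with x hx
      have hx : x < 1 := hx
      exact Set.mem_Ioi.2 (by linarith)
  refine (h2.comp h3).congr fun x => ?_
  simp

theorem Filter.Tendsto.polylogSeries {s : ℕ} (hs : 2 ≤ s) {α : Type*} {l : Filter α} {v : α → ℂ}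
    {c : ℂ} (hv : Tendsto v l (𝓝 c)) (hc : ‖c‖ ≤ 1) (hle : ∀ᶠ x in l, ‖v x‖ ≤ 1) :
    Tendsto (fun x => polylogSeries s (v x)) l (𝓝 (polylogSeries s c)) := by
  have h := continuousOn_polylogSeries hs c (by simpa using hc)
  exact h.tendsto.comp (tendsto_nhdsWithin_iff.2 ⟨hv, hle.mono fun x hx => by simpa using hx⟩)

/-- Stated through the logarithmic derivative `r = v'/v`, which is the same for `v` and `-iv`; the
two dilogarithms in each antiderivative then combine. -/
theorem HasDerivAt.dilog {v : ℝ → ℂ} {v' r : ℂ} {x : ℝ} (hv : HasDerivAt v v' x) (h1 : ‖v x‖ < 1)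
    (h0 : v x ≠ 0) (hr : v' = r * v x) :
    HasDerivAt (fun y => polylogSeries 2 (v y)) (-Complex.log (1 - v x) * r) x := by
  have h := (hasDerivAt_dilog h1 h0).comp x hv
  convert! h using 1
  rw [hr]
  field_simp

theorem HasDerivAt.trilog {v : ℝ → ℂ} {v' r : ℂ} {x : ℝ} (hv : HasDerivAt v v' x) (h1 : ‖v x‖ < 1)
    (h0 : v x ≠ 0) (hr : v' = r * v x) :
    HasDerivAt (fun y => polylogSeries 3 (v y)) (polylogSeries 2 (v x) * r) x := by
  have h := (hasDerivAt_polylogSeries 2 h1 h0).comp x hv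
  convert! h using 1
  rw [hr]
  field_simp

theorem Complex.log_eq_of_exp_eq {z u : ℂ} (h : Complex.exp u = z) (h1 : -Real.pi < u.im)
    (h2 : u.im ≤ Real.pi) : Complex.log z = u := by
  rw [← h, Complex.log_exp h1 h2]

theorem Complex.log_one_add_I :
    Complex.log (1 + Complex.I) = ((Real.log 2 / 2 : ℝ) : ℂ) + ((Real.pi / 4 : ℝ) : ℂ) * Complex.I := by
  have hpi := Real.pi_pos
  have him : (((Real.log 2 / 2 : ℝ) : ℂ) + ((Real.pi / 4 : ℝ) : ℂ) * Complex.I).im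
      = Real.pi / 4 := by
    rw [Complex.add_im, Complex.ofReal_im, Complex.im_ofReal_mul, Complex.I_im]
    ring
  refine Complex.log_eq_of_exp_eq ?_ (by linarith) (by linarith)
  have h2 : Real.exp (Real.log 2 / 2) = √2 := by
    rw [Real.exp_half, Real.exp_log two_pos]
  rw [Complex.exp_add, ← Complex.ofReal_exp, h2, Complex.exp_mul_I, ← Complex.ofReal_cos,
    ← Complex.ofReal_sin, Real.cos_pi_div_four, Real.sin_pi_div_four]
  have h3 : ((√2 : ℝ) : ℂ) * (√2 : ℝ) = 2 := by
    rw [← Complex.ofReal_mul, Real.mul_self_sqrt two_pos.le]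
    simp
  push_cast
  linear_combination (1 / 2 + Complex.I / 2) * h3

theorem one_add_I_mul_ne_zero (x : ℝ) : 1 + Complex.I * x ≠ 0 := fun h => by
  have := congrArg Complex.re h
  simp at this

theorem one_add_ofReal_ne_zero {x : ℝ} (hx : 0 ≤ x) : (1 : ℂ) + x ≠ 0 := by
  have : (1 : ℝ) + x ≠ 0 := by positivity
  exact_mod_cast this

theorem norm_one_add_I_mul_sq (x : ℝ) : ‖1 + Complex.I * x‖ ^ 2 = 1 + x ^ 2 := by
  rw [← Complex.normSq_eq_norm_sq, Complex.normSq_apply]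
  simp
  ring

/-- `log (1 + i x)`. -/
noncomputable def logOneAddI (x : ℝ) : ℂ := Complex.log (1 + Complex.I * x)

theorem hasDerivAt_one_add_I_mul (x : ℝ) :
    HasDerivAt (fun y : ℝ => 1 + Complex.I * (y : ℂ)) Complex.I x := by
  have h := ((hasDerivAt_id (x : ℂ)).const_mul Complex.I).const_add 1
  simpa using h.comp_ofReal

theorem hasDerivAt_logOneAddI (x : ℝ) :
    HasDerivAt logOneAddI (Complex.I / (1 + Complex.I * x)) x :=
  (hasDerivAt_one_add_I_mul x).clog_real (Or.inl (by simp))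

theorem logOneAddI_zero : logOneAddI 0 = 0 := by simp [logOneAddI]

theorem hasDerivAt_ofReal_log {x : ℝ} (hx : x ≠ 0) :
    HasDerivAt (fun y : ℝ => (Real.log y : ℂ)) (1 / (x : ℂ)) x := by
  have := (Real.hasDerivAt_log hx).ofReal_comp
  simpa using this

theorem hasDerivAt_ofReal_log_one_sub {x : ℝ} (hx : x < 1) :
    HasDerivAt (fun y : ℝ => (Real.log (1 - y) : ℂ)) (-1 / (1 - (x : ℂ))) x := by
  have := (((hasDerivAt_id x).const_sub 1).log (by simp; linarith)).ofReal_comp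
  simpa using this

theorem hasDerivAt_ofReal_log_one_add {x : ℝ} (hx : 0 ≤ x) :
    HasDerivAt (fun y : ℝ => (Real.log (1 + y) : ℂ)) (1 / (1 + (x : ℂ))) x := by
  have := (((hasDerivAt_id x).const_add 1).log (by simp; linarith)).ofReal_comp
  simpa using this

theorem Complex.norm_div_lt_one {a b : ℂ} (h : ‖a‖ ^ 2 < ‖b‖ ^ 2) : ‖a / b‖ < 1 := by
  have hb : 0 < ‖b‖ := by
    rcases (norm_nonneg b).eq_or_lt with h0 | h0
    · rw [← h0] at h
      nlinarith [sq_nonneg ‖a‖]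
    · exact h0
  rw [norm_div, div_lt_one hb]
  exact lt_of_pow_lt_pow_left₀ 2 hb.le h

theorem Complex.log_one_sub_I :
    Complex.log (1 - Complex.I) = ((Real.log 2 / 2 : ℝ) : ℂ) - ((Real.pi / 4 : ℝ) : ℂ) * Complex.I := by
  have h := Complex.log_conj (1 + Complex.I)
    (Complex.mem_slitPlane_iff_arg.1 (Or.inl (by simp))).1
  rw [Complex.log_one_add_I] at h
  simp only [map_add, map_mul, map_one, Complex.conj_ofReal, Complex.conj_I] at h
  rw [sub_eq_add_neg, h]
  ring

theorem norm_one_sub_ofReal_sq (x : ℝ) : ‖(1 : ℂ) - x‖ ^ 2 = (1 - x) ^ 2 := by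
  rw [← Complex.ofReal_one, ← Complex.ofReal_sub, Complex.norm_real, Real.norm_eq_abs, sq_abs]

theorem norm_one_add_ofReal_sq (x : ℝ) : ‖(1 : ℂ) + x‖ ^ 2 = (1 + x) ^ 2 := by
  rw [← Complex.ofReal_one, ← Complex.ofReal_add, Complex.norm_real, Real.norm_eq_abs, sq_abs]

theorem norm_neg_I_mul (z : ℂ) : ‖-Complex.I * z‖ = ‖z‖ := by simp

theorem log_one_sub_I_div (x : ℝ) (hx : 0 < x) :
    Complex.log (1 - 1 / (1 + Complex.I * x))
      = (Real.log x : ℂ) + (Real.pi / 2 : ℝ) * Complex.I - logOneAddI x := by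
  have h0 := one_add_I_mul_ne_zero x
  have e : 1 - 1 / (1 + Complex.I * x) = (x : ℂ) * (Complex.I / (1 + Complex.I * x)) := by
    field_simp
    ring
  have hpi := Real.pi_pos
  rw [e, Complex.log_ofReal_mul hx (div_ne_zero Complex.I_ne_zero h0), add_sub_assoc]
  congr 1
  -- This keeps `π/2 - Im L` inside `(0, π)`, so the principal branch is respected.
  have harg : |(logOneAddI x).im| < Real.pi / 2 := by
    rw [logOneAddI, Complex.log_im]
    exact Complex.abs_arg_lt_pi_div_two_iff.2 (Or.inl (by simp))
  rw [abs_lt] at harg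
  have him : (((Real.pi / 2 : ℝ) : ℂ) * Complex.I - logOneAddI x).im
      = Real.pi / 2 - (logOneAddI x).im := by
    rw [Complex.sub_im, Complex.im_ofReal_mul, Complex.I_im, mul_one]
  refine Complex.log_eq_of_exp_eq ?_ (by rw [him]; linarith) (by rw [him]; linarith)
  rw [Complex.exp_sub, logOneAddI, Complex.exp_log h0]
  push_cast
  rw [Complex.exp_pi_div_two_mul_I]

/-- For `v = (1-x)/(1+ix)` the quotient `(1-v)/(1+iv)` is exactly `x`. This is why `Li(v) - Li(-iv)`
appears in the antiderivative: it differentiates to a multiple of `log x`. -/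
theorem log_one_sub_sub_log_one_add_I_mul {x : ℝ} (hx0 : 0 < x) :
    Complex.log (1 - (1 - x) / (1 + Complex.I * x))
      - Complex.log (1 - -Complex.I * ((1 - x) / (1 + Complex.I * x))) = Real.log x := by
  have h0 := one_add_I_mul_ne_zero x
  have h1 : (1 : ℂ) + Complex.I ≠ 0 := by simpa using one_add_I_mul_ne_zero 1
  have e1 : 1 - -Complex.I * ((1 - (x : ℂ)) / (1 + Complex.I * x))
      = (1 + Complex.I) / (1 + Complex.I * x) := by
    field_simp
    ring
  have e2 : 1 - (1 - (x : ℂ)) / (1 + Complex.I * x)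
      = (x : ℂ) * ((1 + Complex.I) / (1 + Complex.I * x)) := by
    rw [one_sub_div h0]
    ring
  rw [e1, e2, Complex.log_ofReal_mul hx0 (div_ne_zero h1 h0)]
  ring

/-- The same device for `v = (1+ix)/(1+x)`, where the quotient is `x(1-i)/(1+i) = -ix`. This
accounts for the extra `-iπ/2`. -/
theorem log_one_sub_sub_log_one_add_I_mul' {x : ℝ} (hx0 : 0 < x) :
    Complex.log (1 - (1 + Complex.I * x) / (1 + x))
      - Complex.log (1 - -Complex.I * ((1 + Complex.I * x) / (1 + x)))
        = Real.log x - (Real.pi / 2 : ℝ) * Complex.I := by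
  have h0 : (1 : ℂ) + x ≠ 0 := one_add_ofReal_ne_zero hx0.le
  have h1 : (1 : ℂ) + Complex.I ≠ 0 := by simpa using one_add_I_mul_ne_zero 1
  have hI := Complex.I_sq
  have h2 : (1 : ℂ) - Complex.I ≠ 0 := fun h => by simpa using congrArg Complex.re h
  have hpos : 0 < 1 / (1 + x) := by positivity
  have hpos' : 0 < x / (1 + x) := by positivity
  have e1 : 1 - -Complex.I * ((1 + Complex.I * (x : ℂ)) / (1 + x))
      = ((1 / (1 + x) : ℝ) : ℂ) * (1 + Complex.I) := by
    push_cast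
    field_simp
    linear_combination (x : ℂ) * hI
  have e2 : 1 - (1 + Complex.I * (x : ℂ)) / (1 + x)
      = ((x / (1 + x) : ℝ) : ℂ) * (1 - Complex.I) := by
    push_cast
    field_simp
    ring
  rw [e1, e2, Complex.log_ofReal_mul hpos h1, Complex.log_ofReal_mul hpos' h2,
    Complex.log_one_add_I, Complex.log_one_sub_I, Real.log_div one_ne_zero (by positivity),
    Real.log_div hx0.ne' (by positivity), Real.log_one]
  push_cast
  ring

/-! ### Trilogarithmic antiderivatives and their endpoint values -/

/-- An antiderivative of `-log² ((1 + ix) / (1 - x)) / x`. -/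
noncomputable def primitiveOneSub (x : ℝ) : ℂ :=
  -(logOneAddI x - Real.log (1 - x)) ^ 2 * Real.log x
    + 2 * (logOneAddI x - Real.log (1 - x))
      * (polylogSeries 2 ((1 - x) / (1 + Complex.I * x))
        - polylogSeries 2 (-Complex.I * ((1 - x) / (1 + Complex.I * x))))
    + 2 * (polylogSeries 3 ((1 - x) / (1 + Complex.I * x))
        - polylogSeries 3 (-Complex.I * ((1 - x) / (1 + Complex.I * x))))

/-- An antiderivative of `log² ((1 + ix) / (1 + x)) / x`. -/
noncomputable def primitiveOneAdd (x : ℝ) : ℂ :=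
  (logOneAddI x - Real.log (1 + x)) ^ 2 * (Real.log x - (Real.pi / 2 : ℝ) * Complex.I)
    + 2 * (logOneAddI x - Real.log (1 + x))
      * (polylogSeries 2 ((1 + Complex.I * x) / (1 + x))
        - polylogSeries 2 (-Complex.I * ((1 + Complex.I * x) / (1 + x))))
    - 2 * (polylogSeries 3 ((1 + Complex.I * x) / (1 + x))
        - polylogSeries 3 (-Complex.I * ((1 + Complex.I * x) / (1 + x))))

/-- An antiderivative of `log² (1 + ix) / x`. -/
noncomputable def primitiveOne (x : ℝ) : ℂ :=
  logOneAddI x ^ 3 / 3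
    + logOneAddI x ^ 2 * (Real.log x + (Real.pi / 2 : ℝ) * Complex.I - logOneAddI x)
    - 2 * logOneAddI x * polylogSeries 2 (1 / (1 + Complex.I * x))
    - 2 * polylogSeries 3 (1 / (1 + Complex.I * x))

theorem hasDerivAt_primitiveOneSub {x : ℝ} (hx0 : 0 < x) (hx1 : x < 1) :
    HasDerivAt primitiveOneSub (-(logOneAddI x - Real.log (1 - x)) ^ 2 / x) x := by
  have h0 := one_add_I_mul_ne_zero x
  have h1 : (1 : ℂ) - x ≠ 0 := by
    have : (1 : ℝ) - x ≠ 0 := by linarith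
    exact_mod_cast this
  have hxc : (x : ℂ) ≠ 0 := by exact_mod_cast hx0.ne'
  have hl := (hasDerivAt_logOneAddI x).sub (hasDerivAt_ofReal_log_one_sub hx1)
  have hv : HasDerivAt (fun y : ℝ => (1 - (y : ℂ)) / (1 + Complex.I * y)) _ x :=
    (Complex.ofRealCLM.hasDerivAt.const_sub 1).div (hasDerivAt_one_add_I_mul x) h0
  have hn : ‖(1 - (x : ℂ)) / (1 + Complex.I * x)‖ < 1 :=
    Complex.norm_div_lt_one (by
      rw [norm_one_sub_ofReal_sq, norm_one_add_I_mul_sq]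
      nlinarith)
  have hne : (1 - (x : ℂ)) / (1 + Complex.I * x) ≠ 0 := div_ne_zero h1 h0
  have hw := hv.const_mul (-Complex.I)
  have hwn := (norm_neg_I_mul _).trans_lt hn
  have hwne : -Complex.I * ((1 - (x : ℂ)) / (1 + Complex.I * x)) ≠ 0 :=
    mul_ne_zero (by simp) hne
  -- The common logarithmic derivative of `v` and `-iv`; it equals minus the derivative of `L -
  -- log(1-x)` because `v = exp(-(L - log(1-x)))`.
  set r : ℂ := -(Complex.I / (1 + Complex.I * x) - -1 / (1 - (x : ℂ))) with hr
  have hvr : ((-Complex.ofRealCLM 1) * (1 + Complex.I * (x : ℂ)) - (1 - (x : ℂ)) * Complex.I)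
      / (1 + Complex.I * x) ^ 2 = r * ((1 - (x : ℂ)) / (1 + Complex.I * x)) := by
    rw [hr]
    simp only [Complex.ofRealCLM_apply, Complex.ofReal_one]
    field_simp
    ring
  have hwr : -Complex.I * (((-Complex.ofRealCLM 1) * (1 + Complex.I * (x : ℂ))
      - (1 - (x : ℂ)) * Complex.I) / (1 + Complex.I * x) ^ 2)
      = r * (-Complex.I * ((1 - (x : ℂ)) / (1 + Complex.I * x))) := by
    rw [hvr]
    ring
  have hlog := log_one_sub_sub_log_one_add_I_mul hx0
  have key := (((hl.pow 2).neg.mul (hasDerivAt_ofReal_log hx0.ne')).add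
    ((hl.const_mul 2).mul ((hv.dilog hn hne hvr).sub (hw.dilog hwn hwne hwr)))).add
    (((hv.trilog hn hne hvr).sub (hw.trilog hwn hwne hwr)).const_mul 2)
  convert! key using 1
  simp only [Pi.sub_apply, Pi.pow_apply, Pi.neg_apply]
  rw [← hlog]
  have hl' : Complex.I / (1 + Complex.I * x) - -1 / (1 - (x : ℂ)) = -r := by rw [hr]; ring
  rw [hl']
  push_cast
  ring

theorem hasDerivAt_primitiveOneAdd {x : ℝ} (hx0 : 0 < x) :
    HasDerivAt primitiveOneAdd ((logOneAddI x - Real.log (1 + x)) ^ 2 / x) x := by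
  have h0 := one_add_I_mul_ne_zero x
  have h1 : (1 : ℂ) + x ≠ 0 := one_add_ofReal_ne_zero hx0.le
  have hxc : (x : ℂ) ≠ 0 := by exact_mod_cast hx0.ne'
  have hl := (hasDerivAt_logOneAddI x).sub (hasDerivAt_ofReal_log_one_add hx0.le)
  have hv : HasDerivAt (fun y : ℝ => (1 + Complex.I * (y : ℂ)) / (1 + y)) _ x :=
    (hasDerivAt_one_add_I_mul x).div (Complex.ofRealCLM.hasDerivAt.const_add 1) h1
  have hn : ‖(1 + Complex.I * (x : ℂ)) / (1 + x)‖ < 1 :=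
    Complex.norm_div_lt_one (by
      rw [norm_one_add_ofReal_sq, norm_one_add_I_mul_sq]
      nlinarith)
  have hne : (1 + Complex.I * (x : ℂ)) / (1 + x) ≠ 0 := div_ne_zero h0 h1
  have hw := hv.const_mul (-Complex.I)
  have hwn := (norm_neg_I_mul _).trans_lt hn
  have hwne : -Complex.I * ((1 + Complex.I * (x : ℂ)) / (1 + x)) ≠ 0 :=
    mul_ne_zero (by simp) hne
  set r : ℂ := Complex.I / (1 + Complex.I * x) - 1 / (1 + (x : ℂ)) with hr
  have hvr : (Complex.I * (1 + (x : ℂ)) - (1 + Complex.I * (x : ℂ)) * Complex.ofRealCLM 1)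
      / (1 + (x : ℂ)) ^ 2 = r * ((1 + Complex.I * (x : ℂ)) / (1 + x)) := by
    rw [hr]
    simp only [Complex.ofRealCLM_apply, Complex.ofReal_one]
    field_simp
  have hwr : -Complex.I * ((Complex.I * (1 + (x : ℂ))
      - (1 + Complex.I * (x : ℂ)) * Complex.ofRealCLM 1) / (1 + (x : ℂ)) ^ 2)
      = r * (-Complex.I * ((1 + Complex.I * (x : ℂ)) / (1 + x))) := by
    rw [hvr]
    ring
  have hlog := log_one_sub_sub_log_one_add_I_mul' hx0
  have key := (((hl.pow 2).mul ((hasDerivAt_ofReal_log hx0.ne').sub_const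
      ((Real.pi / 2 : ℝ) * Complex.I))).add
    ((hl.const_mul 2).mul ((hv.dilog hn hne hvr).sub (hw.dilog hwn hwne hwr)))).sub
    (((hv.trilog hn hne hvr).sub (hw.trilog hwn hwne hwr)).const_mul 2)
  convert! key using 1
  simp only [Pi.sub_apply, Pi.pow_apply]
  rw [← hlog]
  push_cast
  ring

theorem hasDerivAt_primitiveOne {x : ℝ} (hx0 : 0 < x) :
    HasDerivAt primitiveOne (logOneAddI x ^ 2 / x) x := by
  have h0 := one_add_I_mul_ne_zero x
  have hxc : (x : ℂ) ≠ 0 := by exact_mod_cast hx0.ne'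
  have hl := hasDerivAt_logOneAddI x
  have hv : HasDerivAt (fun y : ℝ => 1 / (1 + Complex.I * (y : ℂ))) _ x :=
    (hasDerivAt_const x (1 : ℂ)).div (hasDerivAt_one_add_I_mul x) h0
  have hn : ‖1 / (1 + Complex.I * (x : ℂ))‖ < 1 :=
    Complex.norm_div_lt_one (by
      rw [norm_one_add_I_mul_sq, norm_one]
      nlinarith)
  have hne : 1 / (1 + Complex.I * (x : ℂ)) ≠ 0 := div_ne_zero one_ne_zero h0
  set r : ℂ := -(Complex.I / (1 + Complex.I * x)) with hr
  have hvr : (0 * (1 + Complex.I * (x : ℂ)) - 1 * Complex.I) / (1 + Complex.I * (x : ℂ)) ^ 2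
      = r * (1 / (1 + Complex.I * (x : ℂ))) := by
    rw [hr]
    field_simp
    ring
  have hlog := log_one_sub_I_div x hx0
  have key := ((((hl.pow 3).div_const 3).add ((hl.pow 2).mul (((hasDerivAt_ofReal_log
      hx0.ne').add_const ((Real.pi / 2 : ℝ) * Complex.I)).sub hl))).sub
    ((hl.const_mul 2).mul (hv.dilog hn hne hvr))).sub ((hv.trilog hn hne hvr).const_mul 2)
  convert! key using 1
  simp only [Pi.sub_apply, Pi.pow_apply]
  have hl' : Complex.I / (1 + Complex.I * x) = -r := by rw [hr]; ring
  rw [hlog, hl']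
  push_cast
  ring

theorem norm_one_sub_div_le {x : ℝ} (hx0 : 0 < x) :
    ‖(1 - (x : ℂ)) / (1 + Complex.I * x)‖ ≤ 1 :=
  (Complex.norm_div_lt_one (by
    rw [norm_one_sub_ofReal_sq, norm_one_add_I_mul_sq]
    nlinarith)).le

theorem norm_one_add_I_mul_div_le {x : ℝ} (hx0 : 0 < x) :
    ‖(1 + Complex.I * (x : ℂ)) / (1 + x)‖ ≤ 1 :=
  (Complex.norm_div_lt_one (by
    rw [norm_one_add_ofReal_sq, norm_one_add_I_mul_sq]
    nlinarith)).le

theorem norm_one_div_one_add_I_mul_le {x : ℝ} (hx0 : 0 < x) :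
    ‖1 / (1 + Complex.I * (x : ℂ))‖ ≤ 1 :=
  (Complex.norm_div_lt_one (by
    rw [norm_one_add_I_mul_sq, norm_one]
    nlinarith)).le

theorem eventually_mem_Ioo_nhdsGT_zero : ∀ᶠ x : ℝ in 𝓝[>] 0, 0 < x ∧ x < 1 :=
  Ioo_mem_nhdsGT zero_lt_one

theorem tendsto_logOneAddI_zero : Tendsto logOneAddI (𝓝[>] 0) (𝓝 0) := by
  have := (hasDerivAt_logOneAddI 0).continuousAt.tendsto
  rw [logOneAddI_zero] at this
  exact this.mono_left nhdsWithin_le_nhds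

theorem tendsto_primitiveOneSub_zero : Tendsto primitiveOneSub (𝓝[>] 0)
    (𝓝 (2 * (polylogSeries 3 1 - polylogSeries 3 (-Complex.I)))) := by
  have hd := (hasDerivAt_logOneAddI 0).sub (hasDerivAt_ofReal_log_one_sub zero_lt_one)
  have h0 : (logOneAddI - fun y : ℝ => (Real.log (1 - y) : ℂ)) 0 = 0 := by
    simp [logOneAddI_zero]
  have t1 := tendsto_mul_log_pow_nhdsGT_zero (hd.pow 2).differentiableAt (by simp [h0]) 1
  have t2 := hd.continuousAt.tendsto.mono_left (nhdsWithin_le_nhds (s := Set.Ioi 0))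
  rw [h0] at t2
  have hv : Tendsto (fun y : ℝ => (1 - (y : ℂ)) / (1 + Complex.I * y)) (𝓝[>] 0) (𝓝 1) := by
    have : ContinuousAt (fun y : ℝ => (1 - (y : ℂ)) / (1 + Complex.I * y)) 0 :=
      ContinuousAt.div (by fun_prop) (by fun_prop) (one_add_I_mul_ne_zero 0)
    have := this.tendsto.mono_left (nhdsWithin_le_nhds (s := Set.Ioi 0))
    simpa using this
  have hw := hv.const_mul (-Complex.I)
  rw [mul_one] at hw
  have hle : ∀ᶠ x : ℝ in 𝓝[>] 0, ‖(1 - (x : ℂ)) / (1 + Complex.I * x)‖ ≤ 1 :=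
    eventually_mem_Ioo_nhdsGT_zero.mono fun x hx => norm_one_sub_div_le hx.1
  have hle' : ∀ᶠ x : ℝ in 𝓝[>] 0, ‖-Complex.I * ((1 - (x : ℂ)) / (1 + Complex.I * x))‖ ≤ 1 :=
    hle.mono fun x hx => by rwa [norm_neg_I_mul]
  have hI : ‖-Complex.I‖ ≤ 1 := by simp
  have h1 : ‖(1 : ℂ)‖ ≤ 1 := by simp
  have key := (t1.neg.add ((t2.const_mul 2).mul ((hv.polylogSeries le_rfl h1 hle).sub
    (hw.polylogSeries le_rfl hI hle')))).add
    (((hv.polylogSeries (s := 3) (by norm_num) h1 hle).sub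
      (hw.polylogSeries (s := 3) (by norm_num) hI hle')).const_mul 2)
  simp only [neg_zero, mul_zero, zero_mul, zero_add] at key
  refine key.congr fun x => ?_
  simp only [primitiveOneSub, Pi.sub_apply, Pi.pow_apply, pow_one]
  ring

theorem tendsto_primitiveOneAdd_zero : Tendsto primitiveOneAdd (𝓝[>] 0)
    (𝓝 (-(2 * (polylogSeries 3 1 - polylogSeries 3 (-Complex.I))))) := by
  have hd := (hasDerivAt_logOneAddI 0).sub (hasDerivAt_ofReal_log_one_add le_rfl)
  have h0 : (logOneAddI - fun y : ℝ => (Real.log (1 + y) : ℂ)) 0 = 0 := by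
    simp [logOneAddI_zero]
  have t1 := tendsto_mul_log_pow_nhdsGT_zero (hd.pow 2).differentiableAt (by simp [h0]) 1
  have t2 := hd.continuousAt.tendsto.mono_left (nhdsWithin_le_nhds (s := Set.Ioi 0))
  rw [h0] at t2
  have t3 := (t2.pow 2).mul_const ((Real.pi / 2 : ℝ) * Complex.I)
  have hv : Tendsto (fun y : ℝ => (1 + Complex.I * (y : ℂ)) / (1 + y)) (𝓝[>] 0) (𝓝 1) := by
    have : ContinuousAt (fun y : ℝ => (1 + Complex.I * (y : ℂ)) / (1 + y)) 0 :=
      ContinuousAt.div (by fun_prop) (by fun_prop) (one_add_ofReal_ne_zero le_rfl)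
    have := this.tendsto.mono_left (nhdsWithin_le_nhds (s := Set.Ioi 0))
    simpa using this
  have hw := hv.const_mul (-Complex.I)
  rw [mul_one] at hw
  have hle : ∀ᶠ x : ℝ in 𝓝[>] 0, ‖(1 + Complex.I * (x : ℂ)) / (1 + x)‖ ≤ 1 :=
    eventually_mem_Ioo_nhdsGT_zero.mono fun x hx => norm_one_add_I_mul_div_le hx.1
  have hle' : ∀ᶠ x : ℝ in 𝓝[>] 0, ‖-Complex.I * ((1 + Complex.I * (x : ℂ)) / (1 + x))‖ ≤ 1 :=
    hle.mono fun x hx => by rwa [norm_neg_I_mul]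
  have hI : ‖-Complex.I‖ ≤ 1 := by simp
  have h1 : ‖(1 : ℂ)‖ ≤ 1 := by simp
  have key := ((t1.sub t3).add ((t2.const_mul 2).mul ((hv.polylogSeries le_rfl h1 hle).sub
    (hw.polylogSeries le_rfl hI hle')))).sub
    (((hv.polylogSeries (s := 3) (by norm_num) h1 hle).sub
      (hw.polylogSeries (s := 3) (by norm_num) hI hle')).const_mul 2)
  simp only [mul_zero, zero_mul, zero_add, sub_zero, zero_sub, ne_eq, OfNat.ofNat_ne_zero,
    not_false_eq_true, zero_pow] at key
  refine key.congr fun x => ?_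
  simp only [primitiveOneAdd, Pi.sub_apply, Pi.pow_apply, pow_one]
  ring

theorem tendsto_primitiveOne_zero : Tendsto primitiveOne (𝓝[>] 0)
    (𝓝 (-(2 * polylogSeries 3 1))) := by
  have hd := hasDerivAt_logOneAddI 0
  have t1 := tendsto_mul_log_pow_nhdsGT_zero (hd.pow 2).differentiableAt
    (by simp [logOneAddI_zero]) 1
  have t2 := tendsto_logOneAddI_zero
  have t3 := (t2.pow 2).mul (t2.const_sub ((Real.pi / 2 : ℝ) * Complex.I))
  have hv : Tendsto (fun y : ℝ => 1 / (1 + Complex.I * (y : ℂ))) (𝓝[>] 0) (𝓝 1) := by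
    have : ContinuousAt (fun y : ℝ => 1 / (1 + Complex.I * (y : ℂ))) 0 :=
      ContinuousAt.div (by fun_prop) (by fun_prop) (one_add_I_mul_ne_zero 0)
    have := this.tendsto.mono_left (nhdsWithin_le_nhds (s := Set.Ioi 0))
    simpa using this
  have hle : ∀ᶠ x : ℝ in 𝓝[>] 0, ‖1 / (1 + Complex.I * (x : ℂ))‖ ≤ 1 :=
    eventually_mem_Ioo_nhdsGT_zero.mono fun x hx => norm_one_div_one_add_I_mul_le hx.1
  have h1 : ‖(1 : ℂ)‖ ≤ 1 := by simp
  have key := (((((t2.pow 3).div_const 3).add t1).add t3).sub ((t2.const_mul 2).mul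
    (hv.polylogSeries le_rfl h1 hle))).sub
    ((hv.polylogSeries (s := 3) (by norm_num) h1 hle).const_mul 2)
  simp only [mul_zero, zero_mul, zero_add, sub_zero, zero_sub, ne_eq, OfNat.ofNat_ne_zero,
    not_false_eq_true, zero_pow, zero_div] at key
  refine key.congr fun x => ?_
  simp only [primitiveOne, Pi.pow_apply, pow_one]
  ring

theorem differentiableAt_polylogSeries_one_sub_div (s : ℕ) (c : ℂ) :
    DifferentiableAt ℝ (fun y : ℝ => polylogSeries (s + 1) (c * ((1 - (y : ℂ)) / (1 + Complex.I * y))))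
      1 := by
  have hv : DifferentiableAt ℝ (fun y : ℝ => c * ((1 - (y : ℂ)) / (1 + Complex.I * y))) 1 :=
    DifferentiableAt.const_mul (((Complex.ofRealCLM.hasDerivAt.const_sub 1).div
      (hasDerivAt_one_add_I_mul 1) (one_add_I_mul_ne_zero 1)).differentiableAt) c
  have h := (hasDerivAt_polylogSeries_succ s
    (z := c * ((1 - ((1 : ℝ) : ℂ)) / (1 + Complex.I * (1 : ℝ)))) (by simp)).differentiableAt
  exact (h.restrictScalars ℝ).comp (1 : ℝ) hv

/-- Every power of the singular `log(1-x)` is multiplied by a function that is differentiable and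
zero at `x = 1`: either `log x`, or a polylogarithm difference whose arguments vanish there. -/
theorem tendsto_primitiveOneSub_one : Tendsto primitiveOneSub (𝓝[<] 1) (𝓝 0) := by
  have hL := (hasDerivAt_logOneAddI 1).differentiableAt
  have hlog := (hasDerivAt_ofReal_log one_ne_zero).differentiableAt
  have hd (s : ℕ) : DifferentiableAt ℝ (fun y : ℝ =>
      polylogSeries (s + 1) ((1 - (y : ℂ)) / (1 + Complex.I * y))
      - polylogSeries (s + 1) (-Complex.I * ((1 - (y : ℂ)) / (1 + Complex.I * y)))) 1 := by
    have h := differentiableAt_polylogSeries_one_sub_div s 1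
    simp only [one_mul] at h
    exact h.sub (differentiableAt_polylogSeries_one_sub_div s (-Complex.I))
  -- The last argument is the power of `log(1-x)` in the expanded product; power 0 gives plain
  -- continuity.
  have t1 := tendsto_mul_log_one_sub_pow_nhdsLT_one ((hL.pow 2).mul hlog) (by simp) 0
  have t2 := tendsto_mul_log_one_sub_pow_nhdsLT_one (hL.mul hlog) (by simp) 1
  have t3 := tendsto_mul_log_one_sub_pow_nhdsLT_one hlog (by simp) 2
  have t4 := tendsto_mul_log_one_sub_pow_nhdsLT_one (hL.mul (hd 1)) (by simp) 0
  have t5 := tendsto_mul_log_one_sub_pow_nhdsLT_one (hd 1) (by simp) 1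
  have t6 := tendsto_mul_log_one_sub_pow_nhdsLT_one (hd 2) (by simp) 0
  have key := ((((t2.const_mul 2).sub t1).sub t3).add ((t4.sub t5).const_mul 2)).add
    (t6.const_mul 2)
  simp only [mul_zero, sub_zero, add_zero] at key
  refine key.congr fun x => ?_
  simp only [primitiveOneSub, Pi.mul_apply, Pi.pow_apply, pow_one, pow_zero]
  ring

/-- Euler's reflection `Li₂(z) + Li₂(1-z) + log z · log(1-z) = π²/6` at `z = (1+i)/2`, proved along
the segment from 0 to `z`. There both `z` and `1-z` stay in the unit disc, so the power series
suffices. -/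
theorem dilog_add_dilog_conj :
    polylogSeries 2 ((1 + Complex.I) / 2) + polylogSeries 2 ((1 - Complex.I) / 2)
      = ((5 * Real.pi ^ 2 / 48 - Real.log 2 ^ 2 / 4 : ℝ) : ℂ) := by
  set m : ℂ := (1 + Complex.I) / 2 with hm
  have hm0 : m ≠ 0 := fun h => by simpa [hm] using congrArg Complex.re h
  have hlogm : Complex.log m = ((-(Real.log 2 / 2) : ℝ) : ℂ) + ((Real.pi / 4 : ℝ) : ℂ) * Complex.I := by
    have : m = ((1 / 2 : ℝ) : ℂ) * (1 + Complex.I) := by rw [hm]; push_cast; ring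
    rw [this, Complex.log_ofReal_mul (by norm_num) (fun h => by simpa using congrArg Complex.re h),
      Complex.log_one_add_I, Real.log_div one_ne_zero two_ne_zero, Real.log_one]
    push_cast
    ring
  have hlogm' : Complex.log (1 - m)
      = ((-(Real.log 2 / 2) : ℝ) : ℂ) - ((Real.pi / 4 : ℝ) : ℂ) * Complex.I := by
    have : 1 - m = ((1 / 2 : ℝ) : ℂ) * (1 - Complex.I) := by rw [hm]; push_cast; ring
    rw [this, Complex.log_ofReal_mul (by norm_num) (fun h => by simpa using congrArg Complex.re h),
      Complex.log_one_sub_I, Real.log_div one_ne_zero two_ne_zero, Real.log_one]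
    push_cast
    ring
  have hn1 : ∀ t : ℝ, 0 < t → t ≤ 1 → ‖(t : ℂ) * m‖ < 1 := fun t h0 h1 => by
    refine lt_of_pow_lt_pow_left₀ 2 zero_le_one ?_
    rw [← Complex.normSq_eq_norm_sq, Complex.normSq_apply]
    simp [hm]
    nlinarith
  have hn2 : ∀ t : ℝ, 0 < t → t ≤ 1 → ‖1 - (t : ℂ) * m‖ < 1 := fun t h0 h1 => by
    refine lt_of_pow_lt_pow_left₀ 2 zero_le_one ?_
    rw [← Complex.normSq_eq_norm_sq, Complex.normSq_apply]
    simp [hm]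
    nlinarith
  have hslit : ∀ t : ℝ, t ≤ 1 → 0 < (1 - (t : ℂ) * m).re := fun t h1 => by
    simp [hm]
    linarith
  have hlin : ∀ t : ℝ, HasDerivAt (fun t : ℝ => (t : ℂ) * m) m t := fun t => by
    simpa using Complex.ofRealCLM.hasDerivAt.mul_const m
  -- The left side of the reflection formula at `tm`; its derivative vanishes, so its value at `t =
  -- 1` equals its limit `Li₂(0) + Li₂(1)` at `t = 0`.
  set R : ℝ → ℂ := fun t => polylogSeries 2 (t * m) + polylogSeries 2 (1 - t * m)
    + (Real.log t + Complex.log m) * Complex.log (1 - t * m) with hR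
  have hder : ∀ t : ℝ, 0 < t → t ≤ 1 → HasDerivAt R 0 t := fun t h0 h1 => by
    have ht : (t : ℂ) ≠ 0 := by exact_mod_cast h0.ne'
    have hne : 1 - (t : ℂ) * m ≠ 0 := fun h => by
      have := hslit t h1
      rw [h] at this
      simp at this
    have d1 := (hlin t).dilog (hn1 t h0 h1) (mul_ne_zero ht hm0) (r := 1 / t) (by field_simp)
    have d2 := ((hlin t).const_sub 1).dilog (hn2 t h0 h1) hne (r := -m / (1 - t * m))
      (div_mul_cancel₀ _ hne).symm
    have d3 := (((hasDerivAt_ofReal_log h0.ne').add_const (Complex.log m)).mul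
      (((hlin t).const_sub 1).clog_real (Or.inl (hslit t h1))))
    convert! (d1.add d2).add d3 using 1
    rw [sub_sub_cancel, Complex.log_ofReal_mul h0 hm0]
    ring
  have lim1 : Tendsto R (𝓝[<] 1) (𝓝 (R 1)) :=
    (hder 1 one_pos le_rfl).continuousAt.tendsto.mono_left nhdsWithin_le_nhds
  have lim0 : Tendsto R (𝓝[>] 0) (𝓝 (polylogSeries 2 0 + polylogSeries 2 1)) := by
    have e : Tendsto (fun t : ℝ => (t : ℂ) * m) (𝓝[>] 0) (𝓝 0) := by
      have := (hlin 0).continuousAt.tendsto.mono_left (nhdsWithin_le_nhds (s := Set.Ioi 0))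
      simpa using this
    have e' := e.const_sub 1
    rw [sub_zero] at e'
    have l1 := e.polylogSeries (s := 2) le_rfl (by simp)
      (eventually_mem_Ioo_nhdsGT_zero.mono fun t ht => (hn1 t ht.1 ht.2.le).le)
    have l2 := e'.polylogSeries (s := 2) le_rfl (by simp)
      (eventually_mem_Ioo_nhdsGT_zero.mono fun t ht => (hn2 t ht.1 ht.2.le).le)
    have hc := ((hlin 0).const_sub 1).clog_real (Or.inl (hslit 0 zero_le_one))
    have l3 := tendsto_mul_log_pow_nhdsGT_zero hc.differentiableAt (by simp) 1
    have l4 := (hc.continuousAt.tendsto.mono_left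
      (nhdsWithin_le_nhds (s := Set.Ioi 0))).const_mul (Complex.log m)
    have key := ((l1.add l2).add l3).add l4
    simp only [Complex.ofReal_zero, zero_mul, sub_zero, Complex.log_one, mul_zero, add_zero] at key
    refine key.congr fun t => ?_
    simp only [hR, pow_one]
    ring
  have h := intervalIntegral.integral_eq_sub_of_hasDerivAt_of_tendsto zero_lt_one
    (fun t ht => hder t ht.1 ht.2.le) (by simp) lim0 lim1
  rw [intervalIntegral.integral_zero, eq_comm, sub_eq_zero, polylogSeries_zero,
    polylogSeries_two_one] at h
  simp only [hR, Complex.ofReal_one, one_mul, Real.log_one, Complex.ofReal_zero, zero_add] at h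
  rw [hlogm, hlogm', show 1 - m = (1 - Complex.I) / 2 by rw [hm]; ring] at h
  have hI := Complex.I_sq
  push_cast at h ⊢
  linear_combination h + (Real.pi : ℂ) ^ 2 / 16 * hI

/-! ### The dilogarithm integral -/

/-- The weights `-3, 1, 2` add up to zero, which removes `L²`; the cross terms then give `arctan x`
times the required combination of `log(1-x)` and `log(1+x)`. -/
theorem im_neg_three_mul_sq_add (L a b : ℂ) (ha : a.im = 0) (hb : b.im = 0) :
    (-3 * (L - a) ^ 2 + (L - b) ^ 2 + 2 * L ^ 2).im = L.im * (6 * a.re - 2 * b.re) := by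
  simp [pow_two, ha, hb]
  ring

/-- The real dilogarithm `∑ xⁿ / n²`. -/
noncomputable def realDilog (x : ℝ) : ℝ := (polylogSeries 2 x).re

theorem polylogSeries_two_ofReal (x : ℝ) : polylogSeries 2 (x : ℂ) = (realDilog x : ℂ) := by
  rw [realDilog, Complex.ext_iff]
  refine ⟨by simp, ?_⟩
  have := polylogSeries_conj 2 x
  rw [Complex.conj_ofReal] at this
  rw [Complex.ofReal_im]
  exact Complex.conj_eq_iff_im.1 this.symm

theorem hasDerivAt_realDilog {x : ℝ} (hx : |x| < 1) (h0 : x ≠ 0) :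
    HasDerivAt realDilog (-Real.log (1 - x) / x) x := by
  have h := (hasDerivAt_dilog (z := (x : ℂ)) (by simpa using hx)
    (by exact_mod_cast h0)).real_of_complex
  convert! h using 1
  rw [abs_lt] at hx
  rw [← Complex.ofReal_one, ← Complex.ofReal_sub, ← Complex.ofReal_log (by linarith),
    ← Complex.ofReal_neg, ← Complex.ofReal_div, Complex.ofReal_re]

theorem continuousOn_realDilog : ContinuousOn realDilog (Set.Icc (-1) 1) := by
  refine Complex.continuous_re.comp_continuousOn ((continuousOn_polylogSeries le_rfl).comp
    Complex.continuous_ofReal.continuousOn fun x hx => ?_)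
  simpa [abs_le] using hx

/-- An antiderivative of `(Li₂(-x) - 3 Li₂(x)) / (1 + x²)`. -/
noncomputable def dilogPrimitive (x : ℝ) : ℝ :=
  (logOneAddI x).im * (realDilog (-x) - 3 * realDilog x)
    - (3 * primitiveOneSub x + primitiveOneAdd x + 2 * primitiveOne x).im / 2

theorem im_I_div_one_add_I_mul (x : ℝ) :
    (Complex.I / (1 + Complex.I * x)).im = 1 / (1 + x ^ 2) := by
  rw [Complex.div_im, Complex.normSq_apply]
  simp
  ring

theorem hasDerivAt_dilogPrimitive {x : ℝ} (hx0 : 0 < x) (hx1 : x < 1) :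
    HasDerivAt dilogPrimitive ((realDilog (-x) - 3 * realDilog x) / (1 + x ^ 2)) x := by
  have d1 : HasDerivAt (fun y => (logOneAddI y).im) (1 / (1 + x ^ 2)) x := by
    rw [← im_I_div_one_add_I_mul]
    exact Complex.imCLM.hasFDerivAt.comp_hasDerivAt x (hasDerivAt_logOneAddI x)
  have d2 : HasDerivAt (fun y => realDilog (-y)) (-Real.log (1 + x) / x) x := by
    have h := (hasDerivAt_realDilog (x := -x) (by rw [abs_neg, abs_lt]; constructor <;> linarith)
      (by linarith)).comp x (hasDerivAt_neg x)
    convert! h using 1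
    rw [sub_neg_eq_add]
    field_simp
  have d3 := hasDerivAt_realDilog (x := x) (by rw [abs_lt]; constructor <;> linarith) hx0.ne'
  have d4 := ((((hasDerivAt_primitiveOneSub hx0 hx1).const_mul 3).add
    (hasDerivAt_primitiveOneAdd hx0)).add ((hasDerivAt_primitiveOne hx0).const_mul 2))
  have d5 := Complex.imCLM.hasFDerivAt.comp_hasDerivAt x d4
  have key := (d1.mul (d2.sub (d3.const_mul 3))).sub (d5.div_const 2)
  convert! key using 1
  have e := im_neg_three_mul_sq_add (logOneAddI x) (Real.log (1 - x)) (Real.log (1 + x))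
    (Complex.ofReal_im _) (Complex.ofReal_im _)
  have e2 : 3 * (-(logOneAddI x - (Real.log (1 - x) : ℂ)) ^ 2 / x)
      + (logOneAddI x - (Real.log (1 + x) : ℂ)) ^ 2 / x + 2 * (logOneAddI x ^ 2 / x)
      = (-3 * (logOneAddI x - (Real.log (1 - x) : ℂ)) ^ 2
        + (logOneAddI x - (Real.log (1 + x) : ℂ)) ^ 2 + 2 * logOneAddI x ^ 2) / (x : ℂ) := by
    ring
  rw [e2, Complex.imCLM_apply, Complex.div_ofReal_im, e, Complex.ofReal_re, Complex.ofReal_re]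
  simp only [Pi.sub_apply]
  field_simp
  ring

theorem tendsto_dilogPrimitive_zero :
    Tendsto dilogPrimitive (𝓝[>] 0) (𝓝 (-Real.pi ^ 3 / 16)) := by
  have hneg : Tendsto (fun x : ℝ => realDilog (-x)) (𝓝[>] 0) (𝓝 (realDilog 0)) := by
    have h := (continuousOn_realDilog.continuousAt (x := 0) (Icc_mem_nhds (by norm_num)
      (by norm_num))).tendsto
    have h2 : Tendsto (fun x : ℝ => -x) (𝓝[>] 0) (𝓝 0) := by
      have := (continuous_neg (G := ℝ)).tendsto 0
      rw [neg_zero] at this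
      exact this.mono_left nhdsWithin_le_nhds
    exact h.comp h2
  have hpos : Tendsto realDilog (𝓝[>] 0) (𝓝 (realDilog 0)) :=
    (continuousOn_realDilog.continuousAt (x := 0) (Icc_mem_nhds (by norm_num)
      (by norm_num))).tendsto.mono_left nhdsWithin_le_nhds
  have hL := (Complex.continuous_im.tendsto _).comp tendsto_logOneAddI_zero
  have hK := (Complex.continuous_im.tendsto _).comp (((tendsto_primitiveOneSub_zero.const_mul 3).add
    tendsto_primitiveOneAdd_zero).add (tendsto_primitiveOne_zero.const_mul 2))
  have key := (hL.mul (hneg.sub (hpos.const_mul 3))).sub (hK.div_const 2)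
  convert! key using 2
  have hI : (polylogSeries 3 (-Complex.I)).im = -(Real.pi ^ 3 / 32) := by
    rw [← Complex.conj_I, polylogSeries_conj, Complex.conj_im, im_polylogSeries_three_I]
  -- The same weights cancel `Li₃(1) = ζ(3)` completely.
  have e : 3 * (2 * (polylogSeries 3 1 - polylogSeries 3 (-Complex.I)))
      + -(2 * (polylogSeries 3 1 - polylogSeries 3 (-Complex.I))) + 2 * (-(2 * polylogSeries 3 1))
      = ((-4 : ℝ) : ℂ) * polylogSeries 3 (-Complex.I) := by
    push_cast
    ring
  rw [e, Complex.im_ofReal_mul, hI, Complex.zero_im]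
  ring

/-- All polylogarithm arguments at `x = 1` are `(1+i)/2` or its conjugate. In the imaginary part the
trilogarithms and `Im Li₂` cancel, so only `Re Li₂((1+i)/2)` is needed. -/
theorem im_primitiveOneAdd_add_primitiveOne_one :
    (primitiveOneAdd 1 + 2 * primitiveOne 1).im = -Real.pi ^ 3 / 16 := by
  have hL : logOneAddI 1 = ((Real.log 2 / 2 : ℝ) : ℂ) + ((Real.pi / 4 : ℝ) : ℂ) * Complex.I := by
    rw [logOneAddI, Complex.ofReal_one, mul_one, Complex.log_one_add_I]
  have h1 : (1 : ℂ) + Complex.I ≠ 0 := by simpa using one_add_I_mul_ne_zero 1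
  have e1 : (1 + Complex.I * ((1 : ℝ) : ℂ)) / (1 + ((1 : ℝ) : ℂ)) = (1 + Complex.I) / 2 := by
    push_cast
    norm_num
  have hI := Complex.I_sq
  have e2 : -Complex.I * ((1 + Complex.I) / 2) = (1 - Complex.I) / 2 := by
    linear_combination (-1 / 2 : ℂ) * hI
  have e3 : 1 / (1 + Complex.I * ((1 : ℝ) : ℂ)) = (1 - Complex.I) / 2 := by
    push_cast
    rw [mul_one, div_eq_div_iff h1 two_ne_zero]
    linear_combination hI
  have hconj : (1 - Complex.I) / 2 = starRingEnd ℂ ((1 + Complex.I) / 2) := by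
    rw [map_div₀, map_add, map_one, Complex.conj_I, map_ofNat]
    ring
  have hρ := congrArg Complex.re dilog_add_dilog_conj
  rw [hconj, polylogSeries_conj, Complex.add_re, Complex.conj_re, Complex.ofReal_re] at hρ
  rw [primitiveOneAdd, primitiveOne, e1, e2, e3, hL, hconj, polylogSeries_conj, polylogSeries_conj,
    show (1 : ℝ) + 1 = 2 by norm_num, Real.log_one]
  generalize polylogSeries 2 ((1 + Complex.I) / 2) = A at *
  generalize polylogSeries 3 ((1 + Complex.I) / 2) = B at *
  obtain ⟨ρ, σ⟩ := A
  obtain ⟨τ', τ⟩ := B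
  simp only at hρ
  generalize Real.log 2 = l at *
  generalize Real.pi = p at *
  -- Makes the division by 3 in `primitiveOne` a division by a real number, so that real and
  -- imaginary parts pass through it.
  have c3 : (3 : ℂ) = ((3 : ℝ) : ℂ) := by norm_num
  rw [c3]
  simp only [pow_succ, pow_zero, one_mul, Complex.add_im, Complex.sub_im, Complex.mul_im,
    Complex.add_re, Complex.sub_re, Complex.mul_re, Complex.ofReal_re, Complex.ofReal_im,
    Complex.I_re, Complex.I_im, Complex.conj_re, Complex.conj_im, Complex.div_ofReal_im,
    Complex.div_ofReal_re, Complex.re_ofNat, Complex.im_ofNat]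
  linear_combination (-p / 2) * hρ

theorem tendsto_dilogPrimitive_one :
    Tendsto dilogPrimitive (𝓝[<] 1) (𝓝 (-7 * Real.pi ^ 3 / 48 + Real.pi ^ 3 / 32)) := by
  have hIoo : ∀ᶠ x : ℝ in 𝓝[<] 1, 0 < x ∧ x < 1 := Ioo_mem_nhdsLT zero_lt_one
  have hpos : Tendsto realDilog (𝓝[<] 1) (𝓝 (realDilog 1)) := by
    refine (continuousOn_realDilog 1 (by simp)).tendsto.comp
      (f := fun x : ℝ => x) (tendsto_nhdsWithin_iff.2 ⟨tendsto_id.mono_left nhdsWithin_le_nhds, ?_⟩)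
    exact hIoo.mono fun x hx => ⟨by linarith, hx.2.le⟩
  have hneg : Tendsto (fun x : ℝ => realDilog (-x)) (𝓝[<] 1) (𝓝 (realDilog (-1))) := by
    refine (continuousOn_realDilog (-1) (by simp)).tendsto.comp
      (f := fun x : ℝ => -x) (tendsto_nhdsWithin_iff.2
        ⟨((continuous_neg (G := ℝ)).tendsto 1).mono_left nhdsWithin_le_nhds, ?_⟩)
    exact hIoo.mono fun x hx => ⟨by linarith, by linarith⟩
  have hL := (Complex.continuous_im.tendsto _).comp
    ((hasDerivAt_logOneAddI 1).continuousAt.tendsto.mono_left (nhdsWithin_le_nhds (s := Set.Iio 1)))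
  have t2 := (hasDerivAt_primitiveOneAdd one_pos).continuousAt.tendsto.mono_left
    (nhdsWithin_le_nhds (s := Set.Iio 1))
  have t3 := (hasDerivAt_primitiveOne one_pos).continuousAt.tendsto.mono_left
    (nhdsWithin_le_nhds (s := Set.Iio 1))
  have hK := (Complex.continuous_im.tendsto _).comp (((tendsto_primitiveOneSub_one.const_mul 3).add
    t2).add (t3.const_mul 2))
  have key := (hL.mul (hneg.sub (hpos.const_mul 3))).sub (hK.div_const 2)
  convert! key using 2
  have hl1 : (logOneAddI 1).im = Real.pi / 4 := by
    rw [logOneAddI, Complex.ofReal_one, mul_one, Complex.log_one_add_I, Complex.add_im,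
      Complex.ofReal_im, Complex.im_ofReal_mul, Complex.I_im]
    ring
  have r1 : realDilog 1 = Real.pi ^ 2 / 6 := by
    rw [realDilog, Complex.ofReal_one, polylogSeries_two_one, Complex.ofReal_re]
  have r2 : realDilog (-1) = -Real.pi ^ 2 / 12 := by
    rw [realDilog, Complex.ofReal_neg, Complex.ofReal_one, polylogSeries_two_neg_one,
      Complex.ofReal_re]
  rw [mul_zero, zero_add, im_primitiveOneAdd_add_primitiveOne_one, hl1, r1, r2]
  ring

theorem continuousOn_dilog_div :
    ContinuousOn (fun x : ℝ => (realDilog (-x) - 3 * realDilog x) / (1 + x ^ 2)) (Set.Icc 0 1) := by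
  have h1 : ContinuousOn realDilog (Set.Icc 0 1) :=
    continuousOn_realDilog.mono (Set.Icc_subset_Icc (by norm_num) le_rfl)
  have h2 : ContinuousOn (fun x : ℝ => realDilog (-x)) (Set.Icc 0 1) :=
    continuousOn_realDilog.comp continuous_neg.continuousOn fun x hx =>
      ⟨by linarith [hx.2], by linarith [hx.1]⟩
  exact (h2.sub (h1.const_mul 3)).div (by fun_prop) fun x _ => by positivity

theorem integral_dilog_div_one_add_sq :
    ∫ x in (0 : ℝ)..1, (realDilog (-x) - 3 * realDilog x) / (1 + x ^ 2)
      = -5 * Real.pi ^ 3 / 96 := by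
  rw [intervalIntegral.integral_eq_sub_of_hasDerivAt_of_tendsto zero_lt_one
    (fun x hx => hasDerivAt_dilogPrimitive hx.1 hx.2)
    (continuousOn_dilog_div.intervalIntegrable_of_Icc zero_le_one)
    tendsto_dilogPrimitive_zero tendsto_dilogPrimitive_one]
  ring

/-! ### Summation under the integral sign -/

theorem hasSum_realDilog {x : ℝ} (hx : |x| ≤ 1) :
    HasSum (fun k : ℕ => x ^ (k + 1) / ((k : ℝ) + 1) ^ 2) (realDilog x) := by
  have h := hasSum_polylogSeries (s := 2) le_rfl (z := (x : ℂ)) (by simpa using hx)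
  rw [polylogSeries_two_ofReal] at h
  exact_mod_cast h

theorem realDilog_add_neg {x : ℝ} (hx : |x| ≤ 1) :
    realDilog x + realDilog (-x) = realDilog (x ^ 2) / 2 := by
  have h := polylogSeries_two_add_neg (z := (x : ℂ)) (by simpa using hx)
  rw [← Complex.ofReal_neg, ← Complex.ofReal_pow] at h
  simp only [polylogSeries_two_ofReal] at h
  exact_mod_cast h

theorem hasSum_momentTerm_zero :
    HasSum (fun k => momentTerm 0 (k + 1)) (-5 * Real.pi ^ 3 / 96) := by
  set F : ℕ → ℝ → ℝ := fun k x =>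
    ((x ^ 2) ^ (k + 1) / ((k : ℝ) + 1) ^ 2 / 2 - 4 * (x ^ (k + 1) / ((k : ℝ) + 1) ^ 2)) / (1 + x ^ 2)
    with hF
  have hFc : ∀ k, Continuous (F k) := fun k =>
    Continuous.div (by fun_prop) (by fun_prop) fun x => by positivity
  -- On `[0, 1]` both powers of `x` lie in `[0, 1]`, so `|a/2 - 4b| ≤ 5` with room to spare.
  have hs : Summable fun k : ℕ => 5 * (1 / ((k : ℝ) + 1) ^ 2) :=
    (summable_inv_succ_pow le_rfl).mul_left 5
  have key := intervalIntegral.hasSum_integral_of_dominated_convergence (μ := MeasureTheory.volume)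
    (a := 0) (b := 1) (F := F)
    (f := fun x => (realDilog (-x) - 3 * realDilog x) / (1 + x ^ 2))
    (fun (k : ℕ) _ => 5 * (1 / ((k : ℝ) + 1) ^ 2))
    (fun k => (hFc k).aestronglyMeasurable) ?_ (MeasureTheory.ae_of_all _ fun x _ => hs) (by simp) ?_
  · rw [integral_dilog_div_one_add_sq] at key
    convert! key using 1
    ext k
    rw [momentTerm, arctanMoment, arctanMoment, ← intervalIntegral.integral_div,
      ← intervalIntegral.integral_const_mul, ← intervalIntegral.integral_sub,
      ← intervalIntegral.integral_div]
    · refine intervalIntegral.integral_congr fun x _ => ?_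
      simp only [hF, ← pow_mul]
      have h1 : (k : ℝ) + 1 ≠ 0 := by positivity
      have h2 : 1 + x ^ 2 ≠ 0 := by positivity
      push_cast
      field_simp
      ring_nf
    · exact ((continuous_pow_div_one_add_sq _).div_const 2).intervalIntegrable _ _
    · exact ((continuous_pow_div_one_add_sq _).const_mul 4).intervalIntegrable _ _
  · refine fun k => MeasureTheory.ae_of_all _ fun x hx => ?_
    rw [Set.uIoc_of_le zero_le_one] at hx
    have p1 : 0 ≤ x ^ (k + 1) := pow_nonneg hx.1.le _
    have p2 : x ^ (k + 1) ≤ 1 := pow_le_one₀ hx.1.le hx.2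
    have p3 : 0 ≤ (x ^ 2) ^ (k + 1) := by positivity
    have p4 : (x ^ 2) ^ (k + 1) ≤ 1 := pow_le_one₀ (by positivity) (pow_le_one₀ hx.1.le hx.2)
    have e : F k x = ((x ^ 2) ^ (k + 1) / 2 - 4 * x ^ (k + 1)) / (1 + x ^ 2)
        * (1 / ((k : ℝ) + 1) ^ 2) := by
      simp only [hF]
      ring
    rw [e, norm_mul, Real.norm_of_nonneg (by positivity : 0 ≤ 1 / ((k : ℝ) + 1) ^ 2)]
    refine mul_le_mul_of_nonneg_right ?_ (by positivity)
    rw [Real.norm_eq_abs, abs_div, abs_of_pos (by positivity : 0 < 1 + x ^ 2)]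
    refine (div_le_self (abs_nonneg _) (by nlinarith)).trans ?_
    rw [abs_le]
    constructor <;> linarith
  · refine MeasureTheory.ae_of_all _ fun x hx => ?_
    rw [Set.uIoc_of_le zero_le_one] at hx
    have hx1 : |x| ≤ 1 := abs_le.2 ⟨by linarith [hx.1], hx.2⟩
    have h1 := hasSum_realDilog hx1
    have h2 := hasSum_realDilog (x := x ^ 2) (by rw [abs_pow]; exact pow_le_one₀ (abs_nonneg _) hx1)
    have h3 := ((h2.div_const 2).sub (h1.mul_left 4)).div_const (1 + x ^ 2)
    convert! h3 using 1
    rw [← realDilog_add_neg hx1]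
    ring

/-! ### Solving the recurrence -/

theorem HasSum.momentTerm_succ {n : ℕ} {S : ℝ} (h : HasSum (fun k => momentTerm n (k + 1)) S) :
    HasSum (fun k => momentTerm (n + 1) (k + 1)) (consecutiveSum n - S) := by
  convert! (hasSum_momentTerm_add n).sub h using 1
  ext k
  ring

theorem digammaSeriesHasSum_iff (n : ℕ) (S : ℝ) :
    DigammaSeriesHasSum n S ↔ HasSum (fun k => momentTerm (n + 1) (k + 1)) S := by
  simp only [DigammaSeriesHasSum, digammaTerm_eq]
  exact Complex.hasSum_ofReal

theorem exists_rat_hasSum_momentTerm (n : ℕ) : ∃ b₀ b₁ a₂ a₃ : ℚ,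
    HasSum (fun k => momentTerm n (k + 1)) ((b₀ : ℝ) + (b₁ : ℝ) * Real.log 2
      + (a₂ : ℝ) * Real.pi ^ 2 + (a₃ : ℝ) * Real.pi ^ 3) := by
  induction n with
  | zero =>
    refine ⟨0, 0, 0, -5 / 96, ?_⟩
    convert! hasSum_momentTerm_zero using 1
    push_cast
    ring
  | succ n ih =>
    obtain ⟨b₀, b₁, a₂, a₃, h⟩ := ih
    refine ⟨(2 * harmonic (2 * n + 1) + harmonic n) / (2 * n + 1) ^ 2 - b₀,
      2 / (2 * n + 1) ^ 2 - b₁, -7 / (12 * (2 * n + 1)) - a₂, -a₃, ?_⟩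
    convert! h.momentTerm_succ using 1
    rw [consecutiveSum, realHarmonic, realHarmonic]
    push_cast
    ring

theorem hasSum_momentTerm_one : HasSum (fun k => momentTerm 1 (k + 1))
    (2 * (1 + Real.log 2) - 7 * Real.pi ^ 2 / 12 + 5 * Real.pi ^ 3 / 96) := by
  convert! hasSum_momentTerm_zero.momentTerm_succ using 1
  simp [consecutiveSum, realHarmonic, harmonic_succ]
  ring

theorem hasSum_momentTerm_two : HasSum (fun k => momentTerm 2 (k + 1))
    (-(8 / 9) * (5 / 3 + 2 * Real.log 2) + 7 * Real.pi ^ 2 / 18 - 5 * Real.pi ^ 3 / 96) := by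
  convert! hasSum_momentTerm_one.momentTerm_succ using 1
  simp [consecutiveSum, realHarmonic, harmonic_succ]
  ring

/-- The increment of `T` over two steps. Peeling the newest terms off the harmonic numbers gives the
purely rational summand; the other terms come from differences of `1/(4m+5)` and `1/(4m+3)` and of
their squares. -/
theorem consecutiveSum_sub_of_even (m : ℕ) :
    consecutiveSum (2 * m + 2) - consecutiveSum (2 * m + 1)
      = -16 * (((m : ℝ) + 1) * (2 * realHarmonic (4 * m + 3) + realHarmonic (2 * m + 1)) /
              ((4 * (m : ℝ) + 5) ^ 2 * (4 * (m : ℝ) + 3) ^ 2))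
        + (6 * (m : ℝ) + 7) / (((m : ℝ) + 1) * (4 * (m : ℝ) + 5) ^ 3)
        + 7 * Real.pi ^ 2 / 6 * (1 / ((4 * (m : ℝ) + 5) * (4 * (m : ℝ) + 3)))
        - 32 * Real.log 2 * (((m : ℝ) + 1) / ((4 * (m : ℝ) + 5) ^ 2 * (4 * (m : ℝ) + 3) ^ 2)) := by
  rw [consecutiveSum, consecutiveSum, show 2 * (2 * m + 2) + 1 = 4 * m + 3 + 1 + 1 by ring,
    show 2 * (2 * m + 1) + 1 = 4 * m + 3 by ring, show 2 * m + 2 = 2 * m + 1 + 1 by ring]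
  simp only [realHarmonic, harmonic_succ (4 * m + 3 + 1), harmonic_succ (4 * m + 3),
    harmonic_succ (2 * m + 1)]
  generalize harmonic (4 * m + 3) = a
  generalize harmonic (2 * m + 1) = b
  push_cast
  have h1 : (m : ℝ) + 1 ≠ 0 := by positivity
  have h2 : 4 * (m : ℝ) + 5 ≠ 0 := by positivity
  have h3 : 4 * (m : ℝ) + 3 ≠ 0 := by positivity
  rw [show 2 * (2 * (m : ℝ) + 1 + 1) + 1 = 4 * m + 5 by ring,
    show 2 * (2 * (m : ℝ) + 1) + 1 = 4 * m + 3 by ring,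
    show 4 * (m : ℝ) + 3 + 1 + 1 = 4 * m + 5 by ring,
    show 4 * (m : ℝ) + 3 + 1 = 4 * (m + 1) by ring,
    show 2 * (m : ℝ) + 1 + 1 = 2 * (m + 1) by ring]
  field_simp
  ring

theorem consecutiveSum_sub_of_odd (j : ℕ) :
    consecutiveSum (2 * j + 1) - consecutiveSum (2 * j)
      = -8 * ((2 * (j : ℝ) + 1) * (2 * realHarmonic (4 * j + 1) + realHarmonic (2 * j)) /
              ((4 * (j : ℝ) + 3) ^ 2 * (4 * (j : ℝ) + 1) ^ 2))
        + 4 * ((3 * (j : ℝ) + 2) / ((2 * (j : ℝ) + 1) * (4 * (j : ℝ) + 3) ^ 3))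
        + 7 * Real.pi ^ 2 / 6 * (1 / ((4 * (j : ℝ) + 3) * (4 * (j : ℝ) + 1)))
        - 16 * Real.log 2 *
          ((2 * (j : ℝ) + 1) / ((4 * (j : ℝ) + 3) ^ 2 * (4 * (j : ℝ) + 1) ^ 2)) := by
  rw [consecutiveSum, consecutiveSum, show 2 * (2 * j + 1) + 1 = 4 * j + 1 + 1 + 1 by ring,
    show 2 * (2 * j) + 1 = 4 * j + 1 by ring]
  simp only [realHarmonic, harmonic_succ (4 * j + 1 + 1), harmonic_succ (4 * j + 1),
    harmonic_succ (2 * j)]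
  generalize harmonic (4 * j + 1) = a
  generalize harmonic (2 * j) = b
  push_cast
  have h1 : 2 * (j : ℝ) + 1 ≠ 0 := by positivity
  have h2 : 4 * (j : ℝ) + 3 ≠ 0 := by positivity
  have h3 : 4 * (j : ℝ) + 1 ≠ 0 := by positivity
  rw [show 2 * (2 * (j : ℝ) + 1) + 1 = 4 * j + 3 by ring,
    show 2 * (2 * (j : ℝ)) + 1 = 4 * j + 1 by ring,
    show 4 * (j : ℝ) + 1 + 1 + 1 = 4 * j + 3 by ring,
    show 4 * (j : ℝ) + 1 + 1 = 2 * (2 * j + 1) by ring]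
  field_simp
  ring

/-- Because of the shift by one, odd moment index means even parameter `n = 2m` in the digamma
series. -/
theorem hasSum_momentTerm_odd (m : ℕ) : HasSum (fun k => momentTerm (2 * m + 1) (k + 1))
    (2
        - 16 * ∑ j ∈ Finset.range m,
            ((j : ℝ) + 1) * (2 * realHarmonic (4 * j + 3) + realHarmonic (2 * j + 1)) /
              ((4 * (j : ℝ) + 5) ^ 2 * (4 * (j : ℝ) + 3) ^ 2)
        + ∑ j ∈ Finset.range m,
            (6 * (j : ℝ) + 7) / (((j : ℝ) + 1) * (4 * (j : ℝ) + 5) ^ 3)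
        - 7 * Real.pi ^ 2 / 2 * (1 / 6 - 1 / 3 * ∑ j ∈ Finset.range m,
            1 / ((4 * (j : ℝ) + 5) * (4 * (j : ℝ) + 3)))
        + 2 * Real.log 2 * (1 - 16 * ∑ j ∈ Finset.range m,
            ((j : ℝ) + 1) / ((4 * (j : ℝ) + 5) ^ 2 * (4 * (j : ℝ) + 3) ^ 2))
        + 5 * Real.pi ^ 3 / 96) := by
  induction m with
  | zero =>
    convert! hasSum_momentTerm_one using 1
    simp only [Finset.range_zero, Finset.sum_empty]
    ring
  | succ m ih =>
    convert! ih.momentTerm_succ.momentTerm_succ using 1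
    simp only [Finset.sum_range_succ]
    linear_combination -consecutiveSum_sub_of_even m

/-- Corresponds to `n = 2m + 1`. The base case is the value at `n = 1`, so the increments start at
`j = 1`. -/
theorem hasSum_momentTerm_even (m : ℕ) : HasSum (fun k => momentTerm (2 * m + 2) (k + 1))
    (-40 / 27
        - 8 * ∑ j ∈ Finset.Icc 1 m,
            (2 * (j : ℝ) + 1) * (2 * realHarmonic (4 * j + 1) + realHarmonic (2 * j)) /
              ((4 * (j : ℝ) + 3) ^ 2 * (4 * (j : ℝ) + 1) ^ 2)
        + 4 * ∑ j ∈ Finset.Icc 1 m,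
            (3 * (j : ℝ) + 2) / ((2 * (j : ℝ) + 1) * (4 * (j : ℝ) + 3) ^ 3)
        + 7 * Real.pi ^ 2 / 2 * (1 / 9 + 1 / 3 * ∑ j ∈ Finset.Icc 1 m,
            1 / ((4 * (j : ℝ) + 3) * (4 * (j : ℝ) + 1)))
        - 16 * Real.log 2 * (1 / 9 + ∑ j ∈ Finset.Icc 1 m,
            (2 * (j : ℝ) + 1) / ((4 * (j : ℝ) + 3) ^ 2 * (4 * (j : ℝ) + 1) ^ 2))
        - 5 * Real.pi ^ 3 / 96) := by
  induction m with
  | zero =>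
    convert! hasSum_momentTerm_two using 1
    simp only [Finset.Icc_eq_empty_of_lt zero_lt_one, Finset.sum_empty]
    ring
  | succ m ih =>
    convert! ih.momentTerm_succ.momentTerm_succ using 1
    simp only [Finset.sum_Icc_succ_top (Nat.le_add_left 1 m)]
    linear_combination -consecutiveSum_sub_of_odd (m + 1)

theorem theorem13 (n : ℕ) :
    (∃ b₀ b₁ a₂ a₃ : ℚ, DigammaSeriesHasSum n
      ((b₀ : ℝ) + (b₁ : ℝ) * Real.log 2 + (a₂ : ℝ) * Real.pi ^ 2 + (a₃ : ℝ) * Real.pi ^ 3)) ∧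
    (n = 0 → DigammaSeriesHasSum n
      (2 * (1 + Real.log 2) - 7 * Real.pi ^ 2 / 12 + 5 * Real.pi ^ 3 / 96)) ∧
    (n = 1 → DigammaSeriesHasSum n
      (-(8 / 9) * (5 / 3 + 2 * Real.log 2) + 7 * Real.pi ^ 2 / 18 - 5 * Real.pi ^ 3 / 96)) ∧
    (Odd n → n ≠ 1 → DigammaSeriesHasSum n
      (-40 / 27
        - 8 * ∑ j ∈ Finset.Icc 1 ((n - 1) / 2),
            (2 * (j : ℝ) + 1) * (2 * realHarmonic (4 * j + 1) + realHarmonic (2 * j)) /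
              ((4 * (j : ℝ) + 3) ^ 2 * (4 * (j : ℝ) + 1) ^ 2)
        + 4 * ∑ j ∈ Finset.Icc 1 ((n - 1) / 2),
            (3 * (j : ℝ) + 2) / ((2 * (j : ℝ) + 1) * (4 * (j : ℝ) + 3) ^ 3)
        + 7 * Real.pi ^ 2 / 2 * (1 / 9 + 1 / 3 * ∑ j ∈ Finset.Icc 1 ((n - 1) / 2),
            1 / ((4 * (j : ℝ) + 3) * (4 * (j : ℝ) + 1)))
        - 16 * Real.log 2 * (1 / 9 + ∑ j ∈ Finset.Icc 1 ((n - 1) / 2),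
            (2 * (j : ℝ) + 1) / ((4 * (j : ℝ) + 3) ^ 2 * (4 * (j : ℝ) + 1) ^ 2))
        - 5 * Real.pi ^ 3 / 96)) ∧
    (Even n → DigammaSeriesHasSum n
      (2
        - 16 * ∑ j ∈ Finset.range (n / 2),
            ((j : ℝ) + 1) * (2 * realHarmonic (4 * j + 3) + realHarmonic (2 * j + 1)) /
              ((4 * (j : ℝ) + 5) ^ 2 * (4 * (j : ℝ) + 3) ^ 2)
        + ∑ j ∈ Finset.range (n / 2),
            (6 * (j : ℝ) + 7) / (((j : ℝ) + 1) * (4 * (j : ℝ) + 5) ^ 3)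
        - 7 * Real.pi ^ 2 / 2 * (1 / 6 - 1 / 3 * ∑ j ∈ Finset.range (n / 2),
            1 / ((4 * (j : ℝ) + 5) * (4 * (j : ℝ) + 3)))
        + 2 * Real.log 2 * (1 - 16 * ∑ j ∈ Finset.range (n / 2),
            ((j : ℝ) + 1) / ((4 * (j : ℝ) + 5) ^ 2 * (4 * (j : ℝ) + 3) ^ 2))
        + 5 * Real.pi ^ 3 / 96)) := by
  simp only [digammaSeriesHasSum_iff]
  refine ⟨exists_rat_hasSum_momentTerm (n + 1), ?_, ?_, ?_, ?_⟩
  · rintro rfl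
    exact hasSum_momentTerm_one
  · rintro rfl
    exact hasSum_momentTerm_two
  · rintro ⟨m, rfl⟩ -
    rw [show (2 * m + 1 - 1) / 2 = m by omega]
    exact hasSum_momentTerm_even m
  · intro hn
    obtain ⟨m, rfl⟩ := hn.exists_two_nsmul
    rw [smul_eq_mul, show 2 * m / 2 = m by omega]
    exact hasSum_momentTerm_odd m
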